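/- **Words.** A *prefix-shuffle* is a word $w$ on $\{a,\bar a,b,\bar b\}$ such that every prefix $w'$ of $w$ satisfies $|w'|_a\ge|w'|_{\bar a}$ and $|w'|_b\ge|w'|_{\bar b}$. For $c\in\{a,b\}$, an occurrence of $c$ is *paired* with a later occurrence of $\bar c$ if the subword of letters $c,\bar c$ lying strictly between them is a parenthesis system. Let $w^+$ be $w$ followed by $|w|_a-|w|_{\bar a}$ letters $\bar a$. **Prefix-map.** Maps are rooted, the root being a half-edge that is regarded as a head; a *(planted plane) tree* is a rooted planar map with a single face. The tour of a tree follows its border counterclockwise from the root. Let $T_w$ be the tree such that writing $a$ the first time and $\bar a$ the second time an edge is followed during the tour gives the subword of $w^+$ on $a,\bar a$; orient its edges away from the root. The *prefix-map* $M_w$ is the oriented map obtained from $T_w$ by inserting, while making the tour according to $w$, a head for every $b$ and a tail for every $\bar b$, and by joining the head and tail of paired $b,\bar b$ into an edge. The heads of the non-paired letters $b$ are the *dangling heads*. The edges of $T_w$ whose letter $a$ is not paired in $w$ are *active*; the *rooting heads* are the root, which comes first, and the heads of the active edges. Dangling heads and active edges (hence rooting heads) are ordered by their appearance during the tour of $T_w$.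 **Prefix-forest.** $F_w$ is obtained from $M_w$ by deleting the tails of the active edges and then applying the vertex explosion: each vertex is replaced by as many vertices as it has incident heads, each tail becoming adjacent only to the first head encountered counterclockwise around the vertex starting from that tail, and cyclic orders being preserved. **Tree-sequences.** Let $\tau$ be the tree reduced to a root and a vertex, and let $\sigma(T_1,T_2)$ be the tree obtained from $T_2$ by adding an edge from its root-vertex to $T_1$ (the root of $T_1$ becoming the head of this edge), placed as the first edge encountered clockwise around the root-vertex of $T_2$ starting from its root. The word $\lambda_0(w)$ on the letters $u,v$ and all trees is defined recursively: $\lambda_0(\epsilon)=u\tau v$; $\lambda_0(w'a)$ is obtained from $\lambda_0(w')$ by replacing the last $u$ by $u\tau v$; $\lambda_0(w'b)$ by replacing the first $v$ by $u\tau v$; $\lambda_0(w'\bar a)$ by replacing the factor $T_1vT_2$ around the first $v$ by $\sigma(T_1,T_2)$; $\lambda_0(w'\bar b)$ by replacing the factor $T_1uT_2$ around the last $u$ by $\sigma(T_1,T_2)$. **Proposition.** Let $w$ be a prefix-shuffle, and let $h_1<\cdots<h_k$ be the dangling heads and $h'_1<\cdots<h'_l$ the rooting heads of $M_w$, in order of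 appearance. Then $F_w$ is a forest consisting of exactly $k+l$ trees $t_1,\dots,t_k,t'_1,\dots,t'_l$ (its connected components), the root of $t_i$ being $h_i$ and the root of $t'_i$ being $h'_i$. Moreover $$\lambda_0(w)=u\,t_1\,u\cdots u\,t_k\,u\,t'_l\,v\cdots v\,t'_1\,v .$$ -/

import Mathlib

namespace PrefixShuffle

/-! # Words -/

/-- The alphabet `{a, ā, b, b̄}`. -/
inductive Letter
  | a | aBar | b | bBar
  deriving DecidableEq

/-- For all prefixes `p` of `w`, `|p|_a ≥ |p|_ā` and `|p|_b ≥ |p|_b̄`. -/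
def IsPrefixShuffle (w : List Letter) : Prop :=
  ∀ p ∈ w.inits, p.count .aBar ≤ p.count .a ∧ p.count .bBar ≤ p.count .b

/-- A word `s` on the two letters `c`, `d` is a parenthesis system (`c` opens, `d` closes). -/
def IsParenSystem (c d : Letter) (s : List Letter) : Prop :=
  (∀ x ∈ s, x = c ∨ x = d) ∧ s.count c = s.count d ∧ ∀ p ∈ s.inits, p.count d ≤ p.count c

instance (c d : Letter) (s : List Letter) : Decidable (IsParenSystem c d s) := by
  unfold IsParenSystem; infer_instance

/-- The subword, on the letters `c` and `d`, of the letters of `s` lying strictly between the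
positions `i` and `j` (positions are numbered from `0`). -/
def between (c d : Letter) (s : List Letter) (i j : ℕ) : List Letter :=
  ((s.take j).drop (i + 1)).filter (fun x => decide (x = c ∨ x = d))

/-- The occurrence of `c` at position `i` of `s` is paired with the occurrence of `d` (the letter
`c̄`) at position `j`. -/
def Paired (c d : Letter) (s : List Letter) (i j : ℕ) : Prop :=
  i < j ∧ s[i]? = some c ∧ s[j]? = some d ∧ IsParenSystem c d (between c d s i j)

instance (c d : Letter) (s : List Letter) (i j : ℕ) : Decidable (Paired c d s i j) := by
  unfold Paired; infer_instance

/-- The letter at position `i` of `s` is an occurrence of `c` that is not paired. -/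
def NonPaired (c d : Letter) (s : List Letter) (i : ℕ) : Prop :=
  s[i]? = some c ∧ ∀ j ∈ List.range s.length, ¬ Paired c d s i j

instance (c d : Letter) (s : List Letter) (i : ℕ) : Decidable (NonPaired c d s i) := by
  unfold NonPaired; infer_instance

/-- The word `w⁺`: `w` followed by `|w|_a - |w|_ā` letters `ā`. -/
def plus (w : List Letter) : List Letter :=
  w ++ List.replicate (w.count .a - w.count .aBar) .aBar

/-! # Oriented maps -/

/-- An oriented map given by its rotation system. The half-edge following `x` in counterclockwise
direction around its vertex is `next x`, so that the vertices are the cycles of `next`; the other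
half of the edge carrying `x` is `mate x`, with `mate x = x` when `x` is a half-edge that does not
belong to an edge (the root, or a dangling half-edge). Every half-edge is a head or a tail, and
an edge is made of a head and a tail. -/
structure OrientedMap where
  HalfEdge : Type
  [finite : Finite HalfEdge]
  [decEq : DecidableEq HalfEdge]
  next : Equiv.Perm HalfEdge
  mate : Equiv.Perm HalfEdge
  isHead : HalfEdge → Bool
  mate_mate : ∀ x, mate (mate x) = x
  isHead_mate : ∀ x, mate x ≠ x → isHead (mate x) = !isHead x

attribute [instance] OrientedMap.finite OrientedMap.decEq

theorem exists_return {H : Type} [Finite H] (ρ : Equiv.Perm H) (x : H) :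
    ∃ k, 1 ≤ k ∧ (ρ ^ k) x = x :=
  ⟨orderOf ρ, orderOf_pos ρ, by simp [pow_orderOf_eq_one]⟩

section firstReturn

variable {H L : Type} [Finite H]

theorem exists_return_label (ρ : Equiv.Perm H) (f : H → L) (x : H) :
    ∃ k, 1 ≤ k ∧ f ((ρ ^ k) x) = f x := by
  obtain ⟨k, hk, h⟩ := exists_return ρ x
  exact ⟨k, hk, by rw [h]⟩

variable [DecidableEq L]

/-- The first element met after `x` along the cycle of `x` under `ρ` that has the same label
as `x`. -/
def firstReturnFun (ρ : Equiv.Perm H) (f : H → L) (x : H) : H :=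
  (ρ ^ Nat.find (exists_return_label ρ f x)) x

theorem label_firstReturnFun (ρ : Equiv.Perm H) (f : H → L) (x : H) :
    f (firstReturnFun ρ f x) = f x :=
  (Nat.find_spec (exists_return_label ρ f x)).2

theorem firstReturnFun_aux (ρ : Equiv.Perm H) (f : H → L) (x y : H)
    (h : firstReturnFun ρ f x = firstReturnFun ρ f y)
    (hle : Nat.find (exists_return_label ρ f x) ≤ Nat.find (exists_return_label ρ f y)) :
    x = y := by
  have hf : f x = f y := by
    rw [← label_firstReturnFun ρ f x, ← label_firstReturnFun ρ f y, h]
  have hmin := fun m => Nat.find_min (exists_return_label ρ f y) (m := m)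
  have hx1 := (Nat.find_spec (exists_return_label ρ f x)).1
  unfold firstReturnFun at h
  generalize Nat.find (exists_return_label ρ f x) = k at *
  generalize Nat.find (exists_return_label ρ f y) = m at *
  obtain ⟨d, rfl⟩ := Nat.exists_eq_add_of_le hle
  rw [pow_add, Equiv.Perm.mul_apply] at h
  have hxy : x = (ρ ^ d) y := (ρ ^ k).injective h
  rcases Nat.eq_zero_or_pos d with rfl | hd
  · simpa using hxy
  · exact absurd ⟨hd, by rw [← hxy, hf]⟩ (hmin d (by omega))

theorem firstReturnFun_injective (ρ : Equiv.Perm H) (f : H → L) :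
    Function.Injective (firstReturnFun ρ f) := by
  intro x y h
  rcases le_total (Nat.find (exists_return_label ρ f x)) (Nat.find (exists_return_label ρ f y))
    with hle | hle
  · exact firstReturnFun_aux ρ f x y h hle
  · exact (firstReturnFun_aux ρ f y x h.symm hle).symm

/-- The permutation obtained from `ρ` by cutting its cycles into the classes of equal label, each
class of each cycle keeping the cyclic order. -/
noncomputable def firstReturn (ρ : Equiv.Perm H) (f : H → L) : Equiv.Perm H :=
  Equiv.ofBijective (firstReturnFun ρ f)
    (Finite.injective_iff_bijective.mp (firstReturnFun_injective ρ f))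

theorem label_firstReturn (ρ : Equiv.Perm H) (f : H → L) (x : H) :
    f (firstReturn ρ f x) = f x :=
  label_firstReturnFun ρ f x

end firstReturn

/-- The permutation attached to an involution. -/
def involutionPerm {H : Type} (m : H → H) (h : ∀ x, m (m x) = x) : Equiv.Perm H :=
  Function.Involutive.toPerm m h

theorem involutionPerm_apply {H : Type} (m : H → H) (h : ∀ x, m (m x) = x) (x : H) :
    involutionPerm m h x = m x :=
  rfl

namespace OrientedMap

/-- Deleting the half-edges `x` with `p x = true`. The others keep their cyclic order around
their vertex, and a half-edge whose mate is deleted becomes dangling. -/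
noncomputable def delete (M : OrientedMap) (p : M.HalfEdge → Bool) : OrientedMap where
  HalfEdge := {x : M.HalfEdge // p x = false}
  next := (firstReturn M.next p).subtypePerm (fun x => by rw [label_firstReturn M.next p x])
  mate := involutionPerm (fun x => if h : p (M.mate x.1) = false then ⟨M.mate x.1, h⟩ else x) (by
    intro x
    by_cases h : p (M.mate x.1) = false
    · have hx : p (M.mate (M.mate x.1)) = false := by rw [M.mate_mate]; exact x.2
      simp only [dif_pos h, dif_pos hx]
      exact Subtype.ext (M.mate_mate x.1)
    · simp only [dif_neg h])
  isHead := fun x => M.isHead x.1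
  mate_mate := by
    intro x
    exact Function.Involutive.toPerm_involutive _ x
  isHead_mate := by
    intro x hx
    rw [involutionPerm_apply] at hx ⊢
    by_cases h : p (M.mate x.1) = false
    · rw [dif_pos h] at hx ⊢
      exact M.isHead_mate x.1 (fun e => hx (Subtype.ext e))
    · exact absurd (dif_neg h) hx

theorem exists_head (M : OrientedMap) (x : M.HalfEdge) :
    ∃ k, M.isHead ((M.next ^ k) x) = true ∨ (1 ≤ k ∧ (M.next ^ k) x = x) := by
  obtain ⟨k, hk⟩ := exists_return M.next x
  exact ⟨k, Or.inr hk⟩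

/-- The first head encountered in counterclockwise direction around the vertex of `x` starting
from `x` (it is `x` when `x` is a head; the value is `x` too when the vertex has no head). -/
def firstHead (M : OrientedMap) (x : M.HalfEdge) : M.HalfEdge :=
  (M.next ^ Nat.find (M.exists_head x)) x

/-- The vertex explosion process: each vertex is replaced by as many vertices as it has heads, and
a tail is adjacent to the first head encountered in counterclockwise direction starting from it.
Around each of the new vertices the half-edges keep their cyclic order. -/
noncomputable def explode (M : OrientedMap) : OrientedMap where
  HalfEdge := M.HalfEdge
  next := firstReturn M.next M.firstHead
  mate := M.mate
  isHead := M.isHead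
  mate_mate := M.mate_mate
  isHead_mate := M.isHead_mate

/-- Two half-edges lie in the same connected component. -/
def Joined (M : OrientedMap) (x y : M.HalfEdge) : Prop :=
  Relation.EqvGen (fun x y => y = M.next x ∨ y = M.mate x) x y

theorem joined_next_iff (M : OrientedMap) (r x : M.HalfEdge) :
    M.Joined r (M.next x) ↔ M.Joined r x :=
  ⟨fun h => h.trans _ _ _ (.symm _ _ (.rel _ _ (Or.inl rfl))),
    fun h => h.trans _ _ _ (.rel _ _ (Or.inl rfl))⟩

theorem joined_mate_iff (M : OrientedMap) (r x : M.HalfEdge) :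
    M.Joined r (M.mate x) ↔ M.Joined r x :=
  ⟨fun h => h.trans _ _ _ (.symm _ _ (.rel _ _ (Or.inr rfl))),
    fun h => h.trans _ _ _ (.rel _ _ (Or.inr rfl))⟩

/-- The connected component of the half-edge `r`. -/
def component (M : OrientedMap) (r : M.HalfEdge) : OrientedMap where
  HalfEdge := {x : M.HalfEdge // M.Joined r x}
  next := M.next.subtypePerm (M.joined_next_iff r)
  mate := M.mate.subtypePerm (M.joined_mate_iff r)
  isHead := fun x => M.isHead x.1
  mate_mate := fun x => Subtype.ext (M.mate_mate x.1)
  isHead_mate := fun x hx => M.isHead_mate x.1 (fun e => hx (Subtype.ext e))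

/-- The half-edge `r`, in its component. -/
def componentRoot (M : OrientedMap) (r : M.HalfEdge) : (M.component r).HalfEdge :=
  ⟨r, Relation.EqvGen.refl r⟩

/-- Number of vertices: cycles of `next`. -/
noncomputable def numVertices (M : OrientedMap) : ℕ :=
  Nat.card (Quotient (Equiv.Perm.SameCycle.setoid M.next))

/-- Number of edges (each has exactly one head). -/
noncomputable def numEdges (M : OrientedMap) : ℕ :=
  Nat.card {x : M.HalfEdge // M.isHead x = true ∧ M.mate x ≠ x}

/-- Number of faces: cycles of the permutation `x ↦ next (mate x)`, which follows the borders of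
the faces. -/
noncomputable def numFaces (M : OrientedMap) : ℕ :=
  Nat.card (Quotient (Equiv.Perm.SameCycle.setoid (M.next * M.mate)))

/-- The map `M`, rooted at the half-edge `r`, is a tree: a connected planar map (planarity being
Euler's relation) with a single face, in which `r` is the only half-edge not belonging to an
edge. -/
structure IsTree (M : OrientedMap) (r : M.HalfEdge) : Prop where
  connected : ∀ x, M.Joined r x
  root : ∀ x, M.mate x = x ↔ x = r
  planar : M.numVertices + M.numFaces = M.numEdges + 2
  single_face : M.numFaces = 1

end OrientedMap

/-! # Planted plane trees and the mapping `λ₀` -/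

/-- Planted plane trees: a root-vertex together with the list of the subtrees hanging from its
sons, in their order of appearance around the tree, i.e. in counterclockwise order around the
root-vertex starting from the root. -/
inductive PlaneTree
  | node (sons : List PlaneTree)

/-- The tree reduced to a root and a vertex. -/
def PlaneTree.τ : PlaneTree := .node []

/-- The tree `σ(T₁, T₂)`: a new edge joins the root-vertex of `T₂` to `T₁`, whose root becomes the
head of that edge. This edge is the first one encountered in clockwise order around the root-vertex
of `T₂` starting from the root, i.e. `T₁` becomes the last subtree. -/
def PlaneTree.σ : PlaneTree → PlaneTree → PlaneTree
  | T₁, .node sons => .node (sons ++ [T₁])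

/-- `M.HasShape r t`: exploring the map `M` from the half-edge `r` one finds the planted plane
tree `t`. Counterclockwise around the vertex of `r` there are `r` and then one half-edge per
son of the root-vertex of `t`, and the other half of the `i`-th of these edges is the
root of the `i`-th subtree of `t`. -/
inductive OrientedMap.HasShape (M : OrientedMap) : M.HalfEdge → PlaneTree → Prop
  | node (r : M.HalfEdge) (ts : List PlaneTree)
      (degree : Function.minimalPeriod M.next r = ts.length + 1)
      (edges : ∀ i < ts.length, M.mate ((M.next ^ (i + 1)) r) ≠ (M.next ^ (i + 1)) r)
      (subtrees : ∀ (i : ℕ) (hi : i < ts.length),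
        OrientedMap.HasShape M (M.mate ((M.next ^ (i + 1)) r)) ts[i]) :
      OrientedMap.HasShape M r (.node ts)

/-- The connected component of `r` in `M`, rooted at `r`, is the planted plane tree `t`. -/
def OrientedMap.IsTreeAt (M : OrientedMap) (r : M.HalfEdge) (t : PlaneTree) : Prop :=
  (M.component r).IsTree (M.componentRoot r) ∧ (M.component r).HasShape (M.componentRoot r) t

/-- The letters of tree-sequences: `u`, `v`, and all trees. -/
inductive Symb
  | u | v | tree (T : PlaneTree)

/-- Does the letter `u` occur? -/
def hasU : List Symb → Bool
  | [] => false
  | .u :: _ => true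
  | _ :: s => hasU s

/-- Replace the last occurrence of `u` by `u τ v`. -/
def replaceLastU : List Symb → List Symb
  | [] => []
  | .u :: s => if hasU s then .u :: replaceLastU s else .u :: .tree .τ :: .v :: s
  | x :: s => x :: replaceLastU s

/-- Replace the first occurrence of `v` by `u τ v`. -/
def replaceFirstV : List Symb → List Symb
  | [] => []
  | .v :: s => .u :: .tree .τ :: .v :: s
  | x :: s => x :: replaceFirstV s

/-- Replace by `σ(T₁, T₂)` the subword `T₁ v T₂` around the first occurrence of `v`. -/
def mergeFirstV : List Symb → List Symb
  | [] => []
  | .tree T₁ :: .v :: .tree T₂ :: s => .tree (PlaneTree.σ T₁ T₂) :: s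
  | .v :: s => .v :: s
  | x :: s => x :: mergeFirstV s

/-- Replace by `σ(T₁, T₂)` the subword `T₁ u T₂` around the last occurrence of `u`. -/
def mergeLastU : List Symb → List Symb
  | [] => []
  | .tree T₁ :: .u :: .tree T₂ :: s =>
      if hasU s then .tree T₁ :: mergeLastU (.u :: .tree T₂ :: s)
      else .tree (PlaneTree.σ T₁ T₂) :: s
  | x :: s => x :: mergeLastU s

/-- The tree-sequence of `w' α` from that of `w'`. -/
def lambda0Step (s : List Symb) : Letter → List Symb
  | .a => replaceLastU s
  | .b => replaceFirstV s
  | .aBar => mergeFirstV s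
  | .bBar => mergeLastU s

/-- The mapping `λ₀`, read letter by letter from the left: `λ₀(ε) = u τ v`, and `λ₀(w' α)` is
`lambda0Step (λ₀(w')) α`. -/
def lambda0 (w : List Letter) : List Symb :=
  w.foldl lambda0Step [.u, .tree .τ, .v]

/-! # Prefix-maps -/

/-- The half-edges of the prefix-map of `w`, numbered by the time at which they are encountered
during the tour of the spanning tree, in which the word `w⁺` is written. The half-edge `0` is the
root, and `j + 1` is the half-edge encountered when the letter at position `j` of `w⁺` is written:
the tail of an edge of the tree for `a`, its head for the corresponding `ā`, a head not in the tree
for `b` and a tail not in the tree for `b̄`. -/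
abbrev HalfEdges (w : List Letter) : Type := Fin ((plus w).length + 1)

/-- The letter of `w⁺` written when `x` is encountered; there is none for the root. -/
def letterAt (w : List Letter) (x : HalfEdges w) : Option Letter :=
  if x.val = 0 then none else (plus w)[x.val - 1]?

/-- The letters written at `x` and `y`, or at `y` and `x`, are a paired `c` and `d = c̄` of
`w⁺`. -/
def Linked (c d : Letter) (w : List Letter) (x y : HalfEdges w) : Prop :=
  0 < x.val ∧ 0 < y.val ∧
    (Paired c d (plus w) (x.val - 1) (y.val - 1) ∨ Paired c d (plus w) (y.val - 1) (x.val - 1))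

instance (c d : Letter) (w : List Letter) (x y : HalfEdges w) : Decidable (Linked c d w x y) := by
  unfold Linked; infer_instance

/-- The element related to `x`, or `x` if there is none. -/
def partner {n : ℕ} (R : Fin n → Fin n → Prop) [DecidableRel R] (x : Fin n) : Fin n :=
  ((List.finRange n).find? (fun y => decide (R x y))).getD x

theorem partner_spec {n : ℕ} (R : Fin n → Fin n → Prop) [DecidableRel R] (x : Fin n) :
    R x (partner R x) ∨ ((∀ y, ¬ R x y) ∧ partner R x = x) := by
  unfold partner
  cases h : (List.finRange n).find? (fun y => decide (R x y)) with
  | none =>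
    right
    rw [List.find?_eq_none] at h
    exact ⟨fun y => by simpa using h y (List.mem_finRange y), rfl⟩
  | some y =>
    left
    simpa using List.find?_some h

theorem partner_partner {n : ℕ} (R : Fin n → Fin n → Prop) [DecidableRel R]
    (hs : ∀ x y, R x y → R y x) (hu : ∀ x y z, R x y → R x z → y = z) (x : Fin n) :
    partner R (partner R x) = x := by
  rcases partner_spec R x with h | ⟨h, e⟩
  · rcases partner_spec R (partner R x) with h' | ⟨h', -⟩
    · exact hu _ _ _ h' (hs _ _ h)
    · exact absurd (hs _ _ h) (h' _)
  · rw [e, e]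

theorem Linked.symm {c d : Letter} {w : List Letter} {x y : HalfEdges w}
    (h : Linked c d w x y) : Linked c d w y x :=
  ⟨h.2.1, h.1, h.2.2.symm⟩

theorem between_split {c d : Letter} {s : List Letter} {i k j : ℕ} {l : Letter}
    (hik : i < k) (hkj : k < j) (hk : s[k]? = some l) (hl : l = c ∨ l = d) :
    between c d s i j = between c d s i k ++ l :: between c d s k j := by
  obtain ⟨hlt, rfl⟩ := List.getElem?_eq_some_iff.mp hk
  have h1 : s.take j = s.take k ++ s[k] :: (s.take j).drop (k + 1) := by
    conv_lhs => rw [← List.take_append_drop k (s.take j)]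
    rw [List.take_take, min_eq_left hkj.le,
      List.drop_eq_getElem_cons (by simp; omega), List.getElem_take]
  have h2 : (s.take j).drop (i + 1) =
      (s.take k).drop (i + 1) ++ s[k] :: (s.take j).drop (k + 1) := by
    conv_lhs => rw [h1]
    rw [List.drop_append_of_le_length (by simp; omega)]
  unfold between
  rw [h2, List.filter_append, List.filter_cons_of_pos (by simpa using hl)]

theorem Paired.unique_right {c d : Letter} (hcd : c ≠ d) {s : List Letter} {i j k : ℕ}
    (hj : Paired c d s i j) (hk : Paired c d s i k) : j = k := by
  have aux : ∀ {j k : ℕ}, Paired c d s i j → Paired c d s i k → ¬ j < k := by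
    intro j k hj hk hlt
    have e := between_split (c := c) (d := d) hj.1 hlt hj.2.2.1 (Or.inr rfl)
    have hp := hk.2.2.2.2.2 (between c d s i j ++ [d]) (by
      rw [List.mem_inits, e]; exact ⟨between c d s j k, by simp⟩)
    have hc := hj.2.2.2.2.1
    simp [List.count_append, Ne.symm hcd] at hp
    omega
  rcases lt_trichotomy j k with h | h | h
  · exact absurd h (aux hj hk)
  · exact h
  · exact absurd h (aux hk hj)

theorem Paired.unique_left {c d : Letter} (hcd : c ≠ d) {s : List Letter} {i j k : ℕ}
    (hi : Paired c d s i k) (hj : Paired c d s j k) : i = j := by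
  have aux : ∀ {i j : ℕ}, Paired c d s i k → Paired c d s j k → ¬ i < j := by
    intro i j hi hj hlt
    have e := between_split (c := c) (d := d) hlt hj.1 hj.2.1 (Or.inl rfl)
    have hp := hi.2.2.2.2.2 (between c d s i j) (by
      rw [List.mem_inits, e]; exact List.prefix_append _ _)
    have hc := hi.2.2.2.2.1
    have hc' := hj.2.2.2.2.1
    rw [e] at hc
    simp [List.count_append, hcd] at hc
    omega
  rcases lt_trichotomy i j with h | h | h
  · exact absurd h (aux hi hj)
  · exact h
  · exact absurd h (aux hj hi)

theorem Linked.unique {c d : Letter} (hcd : c ≠ d) {w : List Letter} {x y z : HalfEdges w}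
    (hy : Linked c d w x y) (hz : Linked c d w x z) : y = z := by
  obtain ⟨hx0, hy0, hy⟩ := hy
  obtain ⟨-, hz0, hz⟩ := hz
  apply Fin.ext
  rcases hy with hy | hy <;> rcases hz with hz | hz
  · have := hy.unique_right hcd hz; omega
  · have h := hy.2.1.symm.trans hz.2.2.1; simp [hcd] at h
  · have h := hz.2.1.symm.trans hy.2.2.1; simp [hcd] at h
  · have := hy.unique_left hcd hz; omega

theorem Linked.letterAt {c d : Letter} {w : List Letter} {x y : HalfEdges w}
    (h : Linked c d w x y) :
    (letterAt w x = some c ∧ letterAt w y = some d) ∨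
      (letterAt w x = some d ∧ letterAt w y = some c) := by
  obtain ⟨hx, hy, h⟩ := h
  simp only [PrefixShuffle.letterAt, hx.ne', hy.ne', if_false]
  rcases h with h | h
  · exact Or.inl ⟨h.2.1, h.2.2.1⟩
  · exact Or.inr ⟨h.2.2.1, h.2.1⟩

/-- The matching of the half-edges of the spanning tree: an `a` of `w⁺` with the paired `ā`. -/
def treeMate (w : List Letter) : Equiv.Perm (HalfEdges w) :=
  involutionPerm (partner (Linked .a .aBar w))
    (partner_partner _ (fun _ _ h => h.symm) (fun _ _ _ => Linked.unique (by decide)))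

/-- The two letters at `x` and `y` are paired in `w⁺`. -/
def LinkedAny (w : List Letter) (x y : HalfEdges w) : Prop :=
  Linked .a .aBar w x y ∨ Linked .b .bBar w x y

instance (w : List Letter) (x y : HalfEdges w) : Decidable (LinkedAny w x y) := by
  unfold LinkedAny; infer_instance

theorem LinkedAny.unique {w : List Letter} (x y z : HalfEdges w)
    (hy : LinkedAny w x y) (hz : LinkedAny w x z) : y = z := by
  rcases hy with hy | hy <;> rcases hz with hz | hz
  · exact hy.unique (by decide) hz
  · rcases hy.letterAt with h | h <;> rcases hz.letterAt with h' | h' <;>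
      simp [h.1] at h'
  · rcases hy.letterAt with h | h <;> rcases hz.letterAt with h' | h' <;>
      simp [h.1] at h'
  · exact hy.unique (by decide) hz

/-- Is the half-edge at which this letter is written a head? The root is a head. -/
def headLetter : Option Letter → Bool
  | none => true
  | some .a => false
  | some .aBar => true
  | some .b => true
  | some .bBar => false

/-- The prefix-map `M_w`. During the tour of the spanning tree (counterclockwise around the tree),
after a half-edge `x` one encounters `next (treeMate x)`: an edge of the tree is followed, and a
half-edge not in the tree is crossed. As the half-edges are numbered in the order of the tour, this
is `x + 1` (cyclically), i.e. `next (treeMate x) = finRotate _ x`. -/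
def prefixMap (w : List Letter) : OrientedMap where
  HalfEdge := HalfEdges w
  next := finRotate _ * treeMate w
  mate := involutionPerm (partner (LinkedAny w))
    (partner_partner _ (fun _ _ h => h.imp Linked.symm Linked.symm) LinkedAny.unique)
  isHead := fun x => headLetter (letterAt w x)
  mate_mate := fun x => Function.Involutive.toPerm_involutive _ x
  isHead_mate := by
    intro x hx
    rw [involutionPerm_apply] at hx ⊢
    rcases partner_spec (LinkedAny w) x with (h | h) | ⟨-, h⟩
    · rcases h.letterAt with h | h <;> simp [h.1, h.2, headLetter]
    · rcases h.letterAt with h | h <;> simp [h.1, h.2, headLetter]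
    · exact absurd h hx

/-- The tails of the active edges, i.e. of the edges of the tree whose letter `a` is not paired
in `w`. -/
def isActiveTail (w : List Letter) (x : HalfEdges w) : Bool :=
  decide (0 < x.val ∧ NonPaired .a .aBar w (x.val - 1))

/-- The dangling heads, i.e. the heads whose letter `b` is not paired in `w`. -/
def isDanglingHead (w : List Letter) (x : HalfEdges w) : Bool :=
  decide (0 < x.val ∧ NonPaired .b .bBar w (x.val - 1))

/-- The dangling heads `h_1 < ⋯ < h_k` in their order of appearance. -/
def danglingHeads (w : List Letter) : List (HalfEdges w) :=
  (List.finRange _).filter (isDanglingHead w)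

/-- The rooting heads `h'_1 < ⋯ < h'_l`: the root, and then the heads of the active edges, in the
order of appearance of these edges (an edge appears when its tail is encountered). -/
def rootingHeads (w : List Letter) : List (HalfEdges w) :=
  0 :: ((List.finRange _).filter (isActiveTail w)).map (treeMate w)

/-- The prefix-forest `F_w`: delete the tails of the active edges of `M_w`, then apply the vertex
explosion process. -/
noncomputable def prefixForest (w : List Letter) : OrientedMap :=
  ((prefixMap w).delete (isActiveTail w)).explode

/-- The half-edge of `M_w` from which a half-edge of `F_w` comes. -/
def origin (w : List Letter) (x : (prefixForest w).HalfEdge) : HalfEdges w :=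
  Subtype.val (p := fun y : HalfEdges w => isActiveTail w y = false) x

/-- The word `u t_1 u ⋯ u t_k u t'_l v ⋯ v t'_1 v`. -/
def treeSequence (ts ts' : List PlaneTree) : List Symb :=
  ts.flatMap (fun t => [.u, .tree t]) ++ .u :: ts'.reverse.flatMap (fun t => [.tree t, .v])

end PrefixShuffle

/-!
Read along the tour, the prefix-map and `λ₀` evolve in parallel. After `n` letters, the trees
surrounded by letters `u` are those carried by the heads of the letters `b` not yet paired, and the
trees next to the letters `v` are the corners under construction at the current position of the tour
and at the letters `a` not yet paired. A letter `a` or `b` starts an empty corner after a head; a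
letter `aBar` or `bBar` completes an edge and hangs the tree of its head at the corner preceding its
tail, which is `σ`. The final letters `aBar` of `w⁺` visit the unpaired letters `a` in turn; since
the tails of these are deleted, the corners go unchanged to the rooting heads.

In the prefix-map one moves forward in the tour when passing from a tail to the next half-edge
around its vertex, or from the head of an edge to the half-edge that follows its tail. Hence each
vertex of the exploded map has exactly one head, and each half-edge climbs to a root. The component
of a root is a tree by Euler's relation: its vertices are as many as its heads, and the recursive
exploration of the planted plane tree follows the border of a single face.
-/

namespace PrefixShuffle

/-! # Operations on tree-sequences -/

theorem hasU_append_cons_u (P Q : List Symb) : hasU (P ++ .u :: Q) = true := by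
  induction P with
  | nil => rfl
  | cons x P ih => cases x <;> simp_all [hasU]

theorem hasU_flatMap_tree_v (ts : List PlaneTree) :
    hasU (ts.flatMap fun t => [.tree t, .v]) = false := by
  induction ts with
  | nil => rfl
  | cons t ts ih => simpa [hasU] using ih

theorem replaceLastU_append (P Q : List Symb) (hQ : hasU Q = false) :
    replaceLastU (P ++ .u :: Q) = P ++ .u :: .tree .τ :: .v :: Q := by
  induction P with
  | nil => simp [replaceLastU, hQ]
  | cons x P ih => cases x <;> simp_all [replaceLastU, hasU_append_cons_u]

theorem replaceFirstV_append (P Q : List Symb) (hP : .v ∉ P) :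
    replaceFirstV (P ++ .v :: Q) = P ++ .u :: .tree .τ :: .v :: Q := by
  induction P with
  | nil => rfl
  | cons x P ih => cases x <;> simp_all [replaceFirstV]

theorem mergeFirstV_append (P Q : List Symb) (T₁ T₂ : PlaneTree) (hP : .v ∉ P) :
    mergeFirstV (P ++ .tree T₁ :: .v :: .tree T₂ :: Q) = P ++ .tree (.σ T₁ T₂) :: Q := by
  induction P with
  | nil => rfl
  | cons x P ih =>
    obtain ⟨hx, hP'⟩ := List.ne_and_not_mem_of_not_mem_cons hP
    rw [List.cons_append, List.cons_append, ← ih hP', mergeFirstV]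
    · rintro T T' s - h
      rcases P with - | ⟨y, P⟩
      · simp at h
      · exact hP' (List.mem_cons.mpr (.inl (List.cons.inj h).1.symm))
    · exact fun h => hx h.symm

theorem mergeLastU_append (P Q : List Symb) (T₁ T₂ : PlaneTree) (hQ : hasU Q = false) :
    mergeLastU (P ++ .tree T₁ :: .u :: .tree T₂ :: Q) = P ++ .tree (.σ T₁ T₂) :: Q := by
  induction P with
  | nil => simp [mergeLastU, hQ]
  | cons x P ih =>
    rw [List.cons_append, List.cons_append, ← ih]
    generalize hs : P ++ .tree T₁ :: .u :: .tree T₂ :: Q = s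
    have hasU_of_eq {T s'} (h : s = .u :: .tree T :: s') : hasU s' = true := by
      rcases P with - | ⟨y, - | ⟨z, P⟩⟩
      · simp [← hs] at h
      · simp only [← hs, List.cons_append, List.nil_append, List.cons.injEq] at h
        rw [← h.2.2]; rfl
      · simp only [← hs, List.cons_append, List.cons.injEq] at h
        rw [← h.2.2, List.append_cons]
        exact hasU_append_cons_u _ _
    by_cases hx : ∃ T T' s', x = .tree T ∧ s = .u :: .tree T' :: s'
    · obtain ⟨T, T', s', rfl, rfl⟩ := hx
      rw [mergeLastU, if_pos (hasU_of_eq rfl)]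
    · rw [mergeLastU]
      exact fun T T' s' hT hs' => hx ⟨T, T', s', hT, hs'⟩

theorem lambda0_take_succ {w : List Letter} {n : ℕ} {l : Letter} (h : w[n]? = some l) :
    lambda0 (w.take (n + 1)) = lambda0Step (lambda0 (w.take n)) l := by
  rw [lambda0, lambda0, List.take_add_one, h, Option.toList_some, List.foldl_append,
    List.foldl_cons, List.foldl_nil]

theorem lambda0Step_a_treeSequence (ts ts' : List PlaneTree) :
    lambda0Step (treeSequence ts ts') .a = treeSequence ts (ts' ++ [.τ]) := by
  simp [lambda0Step, treeSequence, replaceLastU_append _ _ (hasU_flatMap_tree_v _)]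

theorem lambda0Step_b_treeSequence (ts ts' : List PlaneTree) (t : PlaneTree) :
    lambda0Step (treeSequence ts (ts' ++ [t])) .b =
      treeSequence (ts ++ [t]) (ts' ++ [.τ]) := by
  have := replaceFirstV_append (ts.flatMap (fun t => [.u, .tree t]) ++ [.u, .tree t])
    (ts'.reverse.flatMap fun t => [.tree t, .v]) (by simp)
  simpa [lambda0Step, treeSequence] using this

theorem lambda0Step_aBar_treeSequence (ts ts' : List PlaneTree) (t₁ t₂ : PlaneTree) :
    lambda0Step (treeSequence ts (ts' ++ [t₂, t₁])) .aBar =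
      treeSequence ts (ts' ++ [.σ t₁ t₂]) := by
  have := mergeFirstV_append (ts.flatMap (fun t => [.u, .tree t]) ++ [.u])
    (.v :: ts'.reverse.flatMap fun t => [.tree t, .v]) t₁ t₂ (by simp)
  simpa [lambda0Step, treeSequence] using this

theorem lambda0Step_bBar_treeSequence (ts ts' : List PlaneTree) (t₁ t₂ : PlaneTree) :
    lambda0Step (treeSequence (ts ++ [t₁]) (ts' ++ [t₂])) .bBar =
      treeSequence ts (ts' ++ [.σ t₁ t₂]) := by
  have := mergeLastU_append (ts.flatMap (fun t => [.u, .tree t]) ++ [.u])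
    (.v :: ts'.reverse.flatMap fun t => [.tree t, .v]) t₁ t₂
    (by simpa [hasU] using hasU_flatMap_tree_v ts'.reverse)
  simpa [lambda0Step, treeSequence] using this

/-! # Pairing of letters -/

section Pairing

variable {c d : Letter} {s : List Letter} {i j k n : ℕ}

theorem lt_length_of_getElem?_eq_some {α : Type*} {s : List α} {x : α} (h : s[n]? = some x) :
    n < s.length :=
  (List.getElem?_eq_some_iff.mp h).1

theorem Paired.lt_length (h : Paired c d s i j) : j < s.length :=
  lt_length_of_getElem?_eq_some h.2.2.1

/-- The positions of the letters `c` that are still waiting for their `d` once the first `n`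
letters of `s` have been read, the last one first. -/
def pending (c d : Letter) (s : List Letter) : ℕ → List ℕ
  | 0 => []
  | n + 1 =>
    if s[n]? = some c then n :: pending c d s n
    else if s[n]? = some d then (pending c d s n).tail
    else pending c d s n

theorem pending_succ_of_open (h : s[n]? = some c) :
    pending c d s (n + 1) = n :: pending c d s n := by
  rw [pending, if_pos h]

theorem pending_succ_of_close (hcd : c ≠ d) (h : s[n]? = some d) :
    pending c d s (n + 1) = (pending c d s n).tail := by
  rw [pending, if_neg (by simpa [h] using hcd.symm), if_pos h]

theorem pending_succ_of_ne (hc : s[n]? ≠ some c) (hd : s[n]? ≠ some d) :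
    pending c d s (n + 1) = pending c d s n := by
  rw [pending, if_neg hc, if_neg hd]

theorem mem_of_mem_pending_succ (h : i ∈ pending c d s (n + 1)) :
    (i = n ∧ s[n]? = some c) ∨ i ∈ pending c d s n := by
  rw [pending] at h
  split_ifs at h with hc
  · exact (List.mem_cons.mp h).imp_left (⟨·, hc⟩)
  · exact .inr (List.mem_of_mem_tail h)
  · exact .inr h

theorem lt_of_mem_pending (h : i ∈ pending c d s n) : i < n := by
  induction n with
  | zero => simp [pending] at h
  | succ n ih =>
    rcases mem_of_mem_pending_succ h with ⟨rfl, -⟩ | h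
    · exact i.lt_succ_self
    · exact (ih h).trans n.lt_succ_self

theorem getElem?_of_mem_pending (h : i ∈ pending c d s n) : s[i]? = some c := by
  induction n with
  | zero => simp [pending] at h
  | succ n ih =>
    rcases mem_of_mem_pending_succ h with ⟨rfl, hc⟩ | h
    · exact hc
    · exact ih h

theorem pairwise_gt_pending (c d : Letter) (s : List Letter) (n : ℕ) :
    (pending c d s n).Pairwise (· > ·) := by
  induction n with
  | zero => simp [pending]
  | succ n ih =>
    rw [pending]
    split_ifs
    · exact List.pairwise_cons.mpr ⟨fun i hi => lt_of_mem_pending hi, ih⟩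
    · exact ih.tail
    · exact ih

theorem isParenSystem_nil : IsParenSystem c d [] := by
  simp [IsParenSystem]

theorem IsParenSystem.append {p q : List Letter} (hp : IsParenSystem c d p)
    (hq : IsParenSystem c d q) : IsParenSystem c d (p ++ q) := by
  obtain ⟨hp_mem, hp_count, hp_inits⟩ := hp
  obtain ⟨hq_mem, hq_count, hq_inits⟩ := hq
  refine ⟨?_, by simp [hp_count, hq_count], ?_⟩
  · simpa [or_imp, forall_and] using And.intro hp_mem hq_mem
  · intro r hr
    rw [List.mem_inits, List.prefix_iff_eq_take] at hr
    rw [hr, List.take_append, List.count_append, List.count_append]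
    exact add_le_add (hp_inits _ ((List.mem_inits _ _).mpr (List.take_prefix _ _)))
      (hq_inits _ ((List.mem_inits _ _).mpr (List.take_prefix _ _)))

theorem IsParenSystem.wrap (hcd : c ≠ d) {p : List Letter} (hp : IsParenSystem c d p) :
    IsParenSystem c d (c :: (p ++ [d])) := by
  obtain ⟨hp_mem, hp_count, hp_inits⟩ := hp
  refine ⟨?_, by simp [hp_count, hcd, hcd.symm], ?_⟩
  · simpa [or_imp, forall_and] using hp_mem
  · intro r hr
    rw [List.mem_inits, List.prefix_cons_iff] at hr
    rcases hr with rfl | ⟨t, rfl, ht⟩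
    · simp
    rcases List.prefix_concat_iff.mp ht with rfl | ht
    · simp [hp_count, hcd, hcd.symm]
    · have := hp_inits t ((List.mem_inits _ _).mpr ht)
      simp only [List.count_cons_of_ne hcd, List.count_cons_self]
      omega

theorem between_succ (hin : i < n) :
    between c d s i (n + 1) =
      between c d s i n ++ s[n]?.toList.filter (fun x => decide (x = c ∨ x = d)) := by
  unfold between
  rw [List.take_add_one, List.drop_append, List.filter_append]
  rcases lt_or_ge n s.length with hn | hn
  · rw [List.length_take_of_le hn.le, Nat.sub_eq_zero_of_le hin, List.drop_zero]
  · simp [hn]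

theorem between_self_succ (i : ℕ) : between c d s i (i + 1) = [] := by
  rw [between, List.drop_eq_nil_of_le (by simp), List.filter_nil]

theorem isParenSystem_between_succ (hcd : c ≠ d) (hki : k < i) (hin : i < n)
    (hi : s[i]? = some c) (hn : s[n]? = some d) (h₁ : IsParenSystem c d (between c d s k i))
    (h₂ : IsParenSystem c d (between c d s i n)) :
    IsParenSystem c d (between c d s k (n + 1)) := by
  have : between c d s k (n + 1) = between c d s k i ++ c :: (between c d s i n ++ [d]) := by
    rw [between_succ (hki.trans hin), between_split hki hin hi (.inl rfl), hn]
    simp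
  exact this ▸ h₁.append (h₂.wrap hcd)

theorem isChain_pending (hcd : c ≠ d) (n : ℕ) :
    (n :: pending c d s n).IsChain fun j i => IsParenSystem c d (between c d s i j) := by
  induction n with
  | zero => simp [pending]
  | succ n ih =>
    by_cases hc : s[n]? = some c
    · rw [pending_succ_of_open hc]
      exact .cons_cons (by simpa [between_self_succ] using isParenSystem_nil) ih
    have lt := fun i => lt_of_mem_pending (c := c) (d := d) (s := s) (i := i) (n := n)
    by_cases hd : s[n]? = some d
    · rw [pending_succ_of_close hcd hd]
      have hgt := pairwise_gt_pending c d s n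
      have hopen := fun i => getElem?_of_mem_pending (c := c) (d := d) (s := s) (i := i) (n := n)
      generalize pending c d s n = p at ih lt hgt hopen ⊢
      rcases p with - | ⟨i, - | ⟨k, l⟩⟩
      · simp
      · simp
      rw [List.isChain_cons_cons, List.isChain_cons_cons] at ih
      obtain ⟨h_in, h_ki, h_l⟩ := ih
      exact .cons_cons (isParenSystem_between_succ hcd (List.rel_of_pairwise_cons hgt (by simp))
        (lt i (by simp)) (hopen i (by simp)) hd h_ki h_in) h_l
    · rw [pending_succ_of_ne hc hd]
      generalize pending c d s n = p at ih lt ⊢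
      rcases p with - | ⟨i, l⟩
      · simp
      · have hbetween : between c d s i (n + 1) = between c d s i n := by
          rw [between_succ (lt i (by simp))]
          cases h : s[n]? <;> simp_all
        rw [List.isChain_cons_cons] at ih ⊢
        rwa [hbetween]

theorem paired_of_pending_eq_cons (hcd : c ≠ d) {l : List ℕ} (hl : pending c d s n = i :: l)
    (hn : s[n]? = some d) : Paired c d s i n := by
  have hi : i ∈ pending c d s n := by simp [hl]
  have hchain := isChain_pending (s := s) hcd n
  rw [hl, List.isChain_cons_cons] at hchain
  exact ⟨lt_of_mem_pending hi, getElem?_of_mem_pending hi, hn, hchain.1⟩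

theorem not_paired_of_mem_pending (hcd : c ≠ d) (hi : i ∈ pending c d s n) (hj : j < n) :
    ¬ Paired c d s i j := by
  induction n with
  | zero => omega
  | succ n ih =>
    intro hp
    have hin : i ∈ pending c d s n := by
      refine (mem_of_mem_pending_succ hi).resolve_left ?_
      rintro ⟨rfl, -⟩
      have := hp.1
      omega
    obtain rfl : j = n := by
      by_contra hne
      exact ih hin (by omega) hp
    rw [pending_succ_of_close hcd hp.2.2.1] at hi
    rcases hl : pending c d s j with - | ⟨k, l⟩
    · simp [hl] at hi
    · have hki := List.rel_of_pairwise_cons (hl ▸ pairwise_gt_pending c d s j)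
        (by simpa [hl] using hi)
      have := hp.unique_left hcd (paired_of_pending_eq_cons hcd hl hp.2.2.1)
      omega

theorem exists_paired_of_notMem_pending (hcd : c ≠ d) (hin : i < n) (hi : s[i]? = some c)
    (hmem : i ∉ pending c d s n) : ∃ j < n, Paired c d s i j := by
  induction n with
  | zero => omega
  | succ n ih =>
    by_cases hp : Paired c d s i n
    · exact ⟨n, n.lt_succ_self, hp⟩
    have hne : i ≠ n := by
      rintro rfl
      simp [pending_succ_of_open hi] at hmem
    suffices hmem' : i ∉ pending c d s n by
      obtain ⟨j, hj, hij⟩ := ih (by omega) hmem'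
      exact ⟨j, hj.trans n.lt_succ_self, hij⟩
    refine fun hmem' => hmem ?_
    rw [pending]
    split_ifs with hc hd
    · exact List.mem_cons_of_mem _ hmem'
    · rcases hl : pending c d s n with - | ⟨k, l⟩
      · simp [hl] at hmem'
      · rw [hl, List.mem_cons] at hmem'
        refine hmem'.resolve_left ?_
        rintro rfl
        exact hp (paired_of_pending_eq_cons hcd hl hd)
    · exact hmem'

theorem nonPaired_iff_mem_pending (hcd : c ≠ d) :
    NonPaired c d s i ↔ i ∈ pending c d s s.length := by
  constructor
  · rintro ⟨hi, hnp⟩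
    by_contra hmem
    obtain ⟨j, hj, hij⟩ := exists_paired_of_notMem_pending hcd
      (lt_length_of_getElem?_eq_some hi) hi hmem
    exact hnp j (List.mem_range.mpr hj) hij
  · exact fun hi => ⟨getElem?_of_mem_pending hi, fun j hj =>
      not_paired_of_mem_pending hcd hi (List.mem_range.mp hj)⟩

theorem length_pending_add_count (hcd : c ≠ d) (hs : ∀ p ∈ s.inits, p.count d ≤ p.count c)
    (hn : n ≤ s.length) :
    (pending c d s n).length + (s.take n).count d = (s.take n).count c := by
  induction n with
  | zero => simp [pending]
  | succ n ih =>
    have hle := hs (s.take (n + 1)) ((List.mem_inits _ _).mpr (List.take_prefix _ _))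
    have hsn := List.getElem?_eq_getElem hn
    specialize ih (by omega)
    rw [List.take_succ_eq_append_getElem hn] at hle ⊢
    by_cases hc : s[n] = c
    · rw [pending_succ_of_open (by rw [hsn, hc])]
      simp only [hc, List.length_cons, List.count_append, List.count_singleton, beq_iff_eq, hcd,
        if_true, if_false]
      omega
    by_cases hd : s[n] = d
    · rw [pending_succ_of_close hcd (by rw [hsn, hd])]
      simp only [hd, List.length_tail, List.count_append, List.count_singleton, beq_iff_eq,
        hcd.symm, if_true, if_false] at hle ⊢
      omega
    · rw [pending_succ_of_ne (by simpa [hsn] using hc) (by simpa [hsn] using hd)]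
      simpa [List.count_singleton, hc, hd, -List.take_append_getElem] using ih

theorem exists_pending_eq_cons (hcd : c ≠ d) (hs : ∀ p ∈ s.inits, p.count d ≤ p.count c)
    (h : s[n]? = some d) : ∃ i l, pending c d s n = i :: l := by
  obtain ⟨hn, hd⟩ := List.getElem?_eq_some_iff.mp h
  refine List.exists_cons_of_length_pos ?_
  have hlen := length_pending_add_count hcd hs hn.le
  have hle := hs (s.take (n + 1)) ((List.mem_inits _ _).mpr (List.take_prefix _ _))
  simp only [List.take_succ_eq_append_getElem hn, hd, List.count_append, List.count_singleton,
    beq_iff_eq, hcd.symm, if_true, if_false] at hle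
  omega

theorem exists_paired_of_close (hcd : c ≠ d) (hs : ∀ p ∈ s.inits, p.count d ≤ p.count c)
    (h : s[j]? = some d) : ∃ i, Paired c d s i j := by
  obtain ⟨i, l, hl⟩ := exists_pending_eq_cons hcd hs h
  exact ⟨i, paired_of_pending_eq_cons hcd hl h⟩

end Pairing

/-! # The words `w` and `w⁺` -/

section Plus

variable {c d l : Letter} {w : List Letter} {i j n : ℕ}

theorem length_le_length_plus (w : List Letter) : w.length ≤ (plus w).length := by
  simp [plus]

theorem getElem?_plus_of_lt (h : n < w.length) : (plus w)[n]? = w[n]? := by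
  rw [plus, List.getElem?_append_left h]

theorem getElem?_plus_of_eq_some (h : w[n]? = some l) : (plus w)[n]? = some l :=
  (getElem?_plus_of_lt (lt_length_of_getElem?_eq_some h)).trans h

theorem getElem?_plus_of_le (h : w.length ≤ n) (h' : n < (plus w).length) :
    (plus w)[n]? = some .aBar := by
  rw [plus, List.getElem?_append_right h, List.getElem?_replicate, if_pos]
  rw [plus, List.length_append, List.length_replicate] at h'
  omega

theorem lt_length_of_getElem?_plus (h : (plus w)[n]? = some l) (hl : l ≠ .aBar) :
    n < w.length := by
  by_contra! hn
  rw [getElem?_plus_of_le hn (lt_length_of_getElem?_eq_some h), Option.some_inj] at h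
  exact hl h.symm

theorem paired_plus_iff (hj : j < w.length) : Paired c d (plus w) i j ↔ Paired c d w i j := by
  have hbetween : between c d (plus w) i j = between c d w i j := by
    rw [between, between, plus, List.take_append_of_le_length hj.le]
  refine and_congr_right fun hij => ?_
  rw [hbetween, getElem?_plus_of_lt hj, getElem?_plus_of_lt (hij.trans hj)]

theorem pending_plus (h : n ≤ w.length) : pending c d (plus w) n = pending c d w n := by
  induction n with
  | zero => rfl
  | succ n ih => rw [pending, pending, getElem?_plus_of_lt h, ih (by omega)]

theorem isPrefixShuffle_plus (hw : IsPrefixShuffle w) : IsPrefixShuffle (plus w) := by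
  intro p hp
  rw [List.mem_inits, List.prefix_iff_eq_take, plus, List.take_append, List.take_replicate] at hp
  rw [hp]
  rcases le_total p.length w.length with h | h
  · simpa [h] using hw _ ((List.mem_inits _ _).mpr (List.take_prefix p.length w))
  · have := hw w (by simp)
    simp only [List.take_of_length_le h, List.count_append, List.count_replicate, beq_iff_eq,
      reduceCtorEq, if_true, if_false]
    omega

theorem IsPrefixShuffle.count_aBar_le (hw : IsPrefixShuffle w) :
    ∀ p ∈ w.inits, p.count .aBar ≤ p.count .a :=
  fun p hp => (hw p hp).1

theorem IsPrefixShuffle.count_bBar_le (hw : IsPrefixShuffle w) :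
    ∀ p ∈ w.inits, p.count .bBar ≤ p.count .b :=
  fun p hp => (hw p hp).2

theorem pending_length_plus (hw : IsPrefixShuffle w) :
    pending .a .aBar (plus w) (plus w).length = [] := by
  have hlen := length_pending_add_count (by decide) (isPrefixShuffle_plus hw).count_aBar_le le_rfl
  have hle := hw.count_aBar_le w (by simp)
  have hcount : (plus w).count .aBar = (plus w).count .a := by
    simp only [plus, List.count_append, List.count_replicate, beq_iff_eq, reduceCtorEq, if_true,
      if_false]
    omega
  rw [List.take_length] at hlen
  rw [← List.length_eq_zero_iff]
  omega

end Plus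

/-! # Cycles of permutations -/

section Perm

variable {H : Type*} {ρ : Equiv.Perm H} {x y : H}

theorem pow_eq_getElem_of_isChain {l : List H} (h : (x :: l).IsChain (ρ · = ·)) (j : ℕ)
    (hj : j < l.length) : (ρ ^ (j + 1)) x = l[j] := by
  induction j generalizing x l with
  | zero =>
    obtain ⟨y, l, rfl⟩ := List.exists_cons_of_length_pos hj
    simpa using (List.isChain_cons_cons.mp h).1
  | succ j ih =>
    obtain ⟨y, l, rfl⟩ := List.exists_cons_of_length_pos (Nat.zero_lt_of_lt hj)
    obtain ⟨hxy, hl⟩ := List.isChain_cons_cons.mp h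
    rw [pow_succ, Equiv.Perm.mul_apply, hxy, ih hl (by simpa using hj), List.getElem_cons_succ]

theorem minimalPeriod_eq_of_isChain {l : List H} (h : (x :: (l ++ [x])).IsChain (ρ · = ·))
    (hx : x ∉ l) : Function.minimalPeriod ρ x = l.length + 1 := by
  have hpow := pow_eq_getElem_of_isChain h
  have hper : Function.IsPeriodicPt ρ (l.length + 1) x := by
    rw [Function.IsPeriodicPt, Function.IsFixedPt, Equiv.Perm.iterate_eq_pow,
      hpow _ (by simp), List.getElem_concat_length rfl]
  refine le_antisymm (hper.minimalPeriod_le (by omega)) ?_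
  by_contra! hlt
  obtain ⟨m, hm⟩ := Nat.exists_eq_succ_of_ne_zero (hper.minimalPeriod_pos (by omega)).ne'
  have hxm : (ρ ^ (m + 1)) x = x := by
    rw [← Nat.succ_eq_add_one, ← hm, ← Equiv.Perm.iterate_eq_pow, Function.iterate_minimalPeriod]
  rw [hpow m (by simp; omega), List.getElem_append_left (by omega)] at hxm
  exact hx (hxm ▸ List.getElem_mem _)

theorem eq_or_exists_pow_of_sameCycle [Finite H] (h : ρ.SameCycle x y) :
    y = x ∨ ∃ i, i + 1 < Function.minimalPeriod ρ x ∧ y = (ρ ^ (i + 1)) x := by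
  obtain ⟨n, rfl⟩ := h.exists_nat_pow_eq
  have hpos : 0 < Function.minimalPeriod ρ x :=
    Function.minimalPeriod_pos_of_mem_periodicPts
      (ρ.injective.mem_periodicPts x)
  rw [← Equiv.Perm.iterate_eq_pow, ← Function.iterate_mod_minimalPeriod_eq]
  rcases hm : n % Function.minimalPeriod ρ x with - | i
  · exact .inl rfl
  · exact .inr ⟨i, hm ▸ Nat.mod_lt _ hpos, by rw [Equiv.Perm.iterate_eq_pow]⟩

theorem apply_eq_of_sameCycle {L : Type*} {f : H → L} (hf : ∀ x, f (ρ x) = f x)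
    (h : ρ.SameCycle x y) : f x = f y := by
  have apply_pow (n : ℕ) (z : H) : f ((ρ ^ n) z) = f z := by
    induction n with
    | zero => rfl
    | succ n ih => rw [pow_succ', Equiv.Perm.mul_apply, hf, ih]
  obtain ⟨n, rfl⟩ := h
  obtain ⟨k, rfl | rfl⟩ := n.eq_nat_or_neg
  · rw [zpow_natCast, apply_pow]
  · simpa using apply_pow k ((ρ ^ (-(k : ℤ))) x)

theorem firstReturn_eq_of_label_eq {H L : Type} [Finite H] [DecidableEq L] {ρ : Equiv.Perm H}
    {f : H → L} {x : H} (h : f (ρ x) = f x) : firstReturn ρ f x = ρ x := by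
  have hfind : Nat.find (exists_return_label ρ f x) = 1 :=
    (Nat.find_eq_iff _).mpr ⟨⟨le_rfl, h⟩, fun k hk hk' => by omega⟩
  change firstReturnFun ρ f x = _
  rw [firstReturnFun, hfind, pow_one]

/-- `FirstKept ρ p x z`: the first element of `x, ρ x, ρ (ρ x), …` which does not satisfy `p`
is `z`. -/
inductive FirstKept (ρ : Equiv.Perm H) (p : H → Bool) : H → H → Prop
  | refl {z : H} (hz : p z = false) : FirstKept ρ p z z
  | step {x z : H} (hx : p x = true) (h : FirstKept ρ p (ρ x) z) : FirstKept ρ p x z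

variable {p : H → Bool} {z z' : H}

theorem FirstKept.eq_of_kept (h : FirstKept ρ p x z) (hx : p x = false) : z = x := by
  cases h with
  | refl => rfl
  | step hx' => simp [hx] at hx'

theorem FirstKept.of_deleted (h : FirstKept ρ p x z) (hx : p x = true) :
    FirstKept ρ p (ρ x) z := by
  cases h with
  | refl hz => simp [hx] at hz
  | step _ h => exact h

theorem FirstKept.unique (h : FirstKept ρ p x z) (h' : FirstKept ρ p x z') : z = z' := by
  induction h with
  | refl hz => exact (h'.eq_of_kept hz).symm
  | step hx _ ih => exact ih (h'.of_deleted hx)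

theorem FirstKept.of_pow {k : ℕ} (hlt : ∀ j < k, p ((ρ ^ j) x) = true)
    (hk : p ((ρ ^ k) x) = false) : FirstKept ρ p x ((ρ ^ k) x) := by
  induction k generalizing x with
  | zero => exact .refl hk
  | succ k ih =>
    rw [pow_succ, Equiv.Perm.mul_apply] at hk ⊢
    refine .step (hlt 0 k.succ_pos) (ih (fun j hj => ?_) hk)
    have := hlt (j + 1) (by omega)
    rwa [pow_succ, Equiv.Perm.mul_apply] at this

theorem firstKept_firstReturn {H : Type} [Finite H] {ρ : Equiv.Perm H} {p : H → Bool} {x : H}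
    (hx : p x = false) :
    FirstKept ρ p (ρ x) (firstReturn ρ p x) := by
  obtain ⟨k, hk⟩ := Nat.exists_eq_add_of_le (Nat.find_spec (exists_return_label ρ p x)).1
  have hret : firstReturn ρ p x = (ρ ^ k) (ρ x) := by
    change (ρ ^ Nat.find (exists_return_label ρ p x)) x = _
    rw [hk, add_comm, pow_succ, Equiv.Perm.mul_apply]
  rw [hret]
  refine .of_pow (fun j hj => ?_) (by rw [← hret, label_firstReturn ρ p x, hx])
  have hmin := Nat.find_min (exists_return_label ρ p x) (m := j + 1) (by omega)
  rw [not_and, hx, pow_succ, Equiv.Perm.mul_apply] at hmin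
  simpa using hmin (by omega)

end Perm

namespace OrientedMap

variable {M : OrientedMap}

/-! # Vertex explosion -/

theorem firstHead_eq_pow {x : M.HalfEdge} {k : ℕ} (hk : M.isHead ((M.next ^ k) x) = true)
    (hlt : ∀ j < k, M.isHead ((M.next ^ j) x) = false) : M.firstHead x = (M.next ^ k) x := by
  have hfind : Nat.find (M.exists_head x) = k := by
    refine (Nat.find_eq_iff _).mpr ⟨.inl hk, fun j hj => ?_⟩
    rintro (h | ⟨hpos, h⟩)
    · simp [hlt j hj] at h
    · have : (M.next ^ k) x = (M.next ^ (k - j)) x := by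
        conv_lhs => rw [← Nat.sub_add_cancel hj.le, pow_add, Equiv.Perm.mul_apply, h]
      simp [this, hlt (k - j) (by omega)] at hk
  rw [firstHead, hfind]

theorem firstHead_of_isHead {x : M.HalfEdge} (hx : M.isHead x = true) : M.firstHead x = x :=
  firstHead_eq_pow (k := 0) hx (by simp)

theorem isHead_firstHead {x : M.HalfEdge} (h : ∃ k, M.isHead ((M.next ^ k) x) = true) :
    M.isHead (M.firstHead x) = true := by
  rw [firstHead_eq_pow (Nat.find_spec h) fun j hj => by simpa using Nat.find_min h hj]
  exact Nat.find_spec h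

theorem firstHead_next_of_tail {x : M.HalfEdge} (hx : M.isHead x = false)
    (h : M.isHead (M.firstHead x) = true) : M.firstHead (M.next x) = M.firstHead x := by
  have hmin := fun m => Nat.find_min (M.exists_head x) (m := m)
  rw [firstHead.eq_1 M x] at h ⊢
  generalize Nat.find (M.exists_head x) = k at hmin h ⊢
  rcases k with - | k
  · simp [hx] at h
  rw [pow_succ, Equiv.Perm.mul_apply] at h ⊢
  refine firstHead_eq_pow h fun j hj => ?_
  have := (not_or.mp (hmin (j + 1) (by omega))).1
  rw [pow_succ, Equiv.Perm.mul_apply] at this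
  simpa using this

theorem firstHead_explode_next (x : M.HalfEdge) :
    M.firstHead (M.explode.next x) = M.firstHead x :=
  label_firstReturn M.next M.firstHead x

theorem explode_next_of_tail {x : M.HalfEdge} (hx : M.isHead x = false)
    (h : M.isHead (M.firstHead x) = true) : M.explode.next x = M.next x :=
  firstReturn_eq_of_label_eq (firstHead_next_of_tail hx h)

theorem explode_next_firstHead {g : M.HalfEdge} (hg : M.isHead g = true)
    (h : M.isHead (M.firstHead (M.next g)) = true) :
    M.explode.next (M.firstHead (M.next g)) = M.next g := by
  obtain ⟨z, hz⟩ : ∃ z : M.HalfEdge, M.explode.next z = M.next g :=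
    M.explode.next.surjective (M.next g)
  have hlabel : M.firstHead z = M.firstHead (M.next g) := by rw [← hz, firstHead_explode_next]
  have hz_head : M.isHead z = true := by
    by_contra hz_tail
    rw [Bool.not_eq_true] at hz_tail
    have hzg := explode_next_of_tail hz_tail (hlabel ▸ h)
    rw [hz] at hzg
    simp [← M.next.injective hzg, hg] at hz_tail
  rw [← hlabel, firstHead_of_isHead hz_head, hz]

theorem hasShape_node_of_isChain {h : M.HalfEdge} {l : List M.HalfEdge} {ts : List PlaneTree}
    (hchain : (h :: (l ++ [h])).IsChain (M.next · = ·)) (hmem : h ∉ l)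
    (hts : List.Forall₂ (fun x t => M.mate x ≠ x ∧ M.HasShape (M.mate x) t) l ts) :
    M.HasShape h (.node ts) := by
  obtain ⟨hlen, hget⟩ := List.forall₂_iff_get.mp hts
  have hpow : ∀ i (hi : i < ts.length), (M.next ^ (i + 1)) h = l[i] := fun i hi => by
    rw [pow_eq_getElem_of_isChain hchain i (by simp; omega), List.getElem_append_left]
  refine .node h ts (hlen ▸ minimalPeriod_eq_of_isChain hchain hmem) (fun i hi => ?_)
    (fun i hi => ?_)
  · rw [hpow i hi]
    exact (hget i (by omega) hi).1
  · rw [hpow i hi]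
    exact (hget i (by omega) hi).2

/-- `M.HasCorner y T`: the tails that precede `y` around its vertex, back to the previous head,
carry in the exploded map the subtrees of the root-vertex of `T`. When `y` is a head, these tails
are its neighbours in the exploded map. -/
inductive HasCorner (M : OrientedMap) : M.HalfEdge → PlaneTree → Prop
  | of_head {h : M.HalfEdge} (hh : M.isHead h = true) : M.HasCorner (M.next h) .τ
  | concat {x : M.HalfEdge} {t T : PlaneTree} (hT : M.HasCorner x T) (hx : M.isHead x = false)
      (hmate : M.mate x ≠ x) (ht : M.explode.HasShape (M.mate x) t) :
      M.HasCorner (M.next x) (.σ t T)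

theorem HasCorner.exists_tails {y : M.HalfEdge} {T : PlaneTree} (h : M.HasCorner y T)
    (hy : M.isHead (M.firstHead y) = true) :
    ∃ (l : List M.HalfEdge) (ts : List PlaneTree), T = .node ts ∧
      (∀ x ∈ l, M.isHead x = false) ∧
      List.Forall₂ (fun x t => M.mate x ≠ x ∧ M.explode.HasShape (M.mate x) t) l ts ∧
      (M.firstHead y :: (l ++ [y])).IsChain (M.explode.next · = ·) := by
  induction h with
  | of_head hh =>
    exact ⟨[], [], rfl, by simp, .nil, List.isChain_pair.mpr (explode_next_firstHead hh hy)⟩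
  | @concat x t T _ hx hmate ht ih =>
    have hx_head : M.isHead (M.firstHead x) = true :=
      isHead_firstHead ⟨_ + 1, by rw [pow_succ, Equiv.Perm.mul_apply]; exact hy⟩
    obtain ⟨l, ts, rfl, htails, hts, hchain⟩ := ih hx_head
    refine ⟨l ++ [x], ts ++ [t], rfl, ?_, ?_, ?_⟩
    · simpa [or_imp, forall_and] using ⟨htails, hx⟩
    · exact List.rel_append hts (.cons ⟨hmate, ht⟩ .nil)
    · rw [firstHead_next_of_tail hx hx_head, List.append_assoc]
      exact List.isChain_cons_split.mpr
        ⟨hchain, List.isChain_pair.mpr (explode_next_of_tail hx hx_head)⟩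

theorem HasCorner.hasShape {h : M.HalfEdge} {T : PlaneTree} (hT : M.HasCorner h T)
    (hh : M.isHead h = true) : M.explode.HasShape h T := by
  obtain ⟨l, ts, rfl, htails, hts, hchain⟩ := hT.exists_tails (by rwa [firstHead_of_isHead hh])
  rw [firstHead_of_isHead hh] at hchain
  exact hasShape_node_of_isChain hchain (fun hmem => by simp [htails h hmem] at hh) hts

/-! # Deletion -/

section Delete

variable {p : M.HalfEdge → Bool}

theorem firstKept_delete_next (x : (M.delete p).HalfEdge) :
    FirstKept M.next p (M.next x.1) ((M.delete p).next x).1 :=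
  firstKept_firstReturn x.2

theorem delete_mate_of_kept {x : (M.delete p).HalfEdge} (h : p (M.mate x.1) = false) :
    (M.delete p).mate x = (⟨M.mate x.1, h⟩ : {x : M.HalfEdge // p x = false}) :=
  dif_pos h

theorem delete_mate_of_deleted {x : (M.delete p).HalfEdge} (h : p (M.mate x.1) = true) :
    (M.delete p).mate x = x :=
  dif_neg (by simp [h])

theorem delete_mate_eq_self_iff {x : (M.delete p).HalfEdge} :
    (M.delete p).mate x = x ↔ M.mate x.1 = x.1 ∨ p (M.mate x.1) = true := by
  cases h : p (M.mate x.1) with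
  | true => simpa using delete_mate_of_deleted h
  | false =>
    rw [delete_mate_of_kept h]
    simp only [Bool.false_eq_true, or_false]
    exact Subtype.ext_iff

/-- The half-edge of `M.delete p` found first, in counterclockwise direction, from the position
`y` has the corner `T`. The half-edge `y` itself may be deleted. -/
def HasCornerAfterDelete (M : OrientedMap) (p : M.HalfEdge → Bool) (y : M.HalfEdge)
    (T : PlaneTree) : Prop :=
  ∀ z : (M.delete p).HalfEdge, FirstKept M.next p y z.1 → (M.delete p).HasCorner z T

theorem HasCornerAfterDelete.of_head {x : M.HalfEdge} (hp : p x = false)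
    (hx : M.isHead x = true) : M.HasCornerAfterDelete p (M.next x) .τ := by
  intro z hz
  let x' : (M.delete p).HalfEdge := ⟨x, hp⟩
  obtain rfl : (M.delete p).next x' = z := Subtype.ext ((firstKept_delete_next x').unique hz)
  exact .of_head hx

theorem HasCornerAfterDelete.next_of_deleted {x : M.HalfEdge} {T : PlaneTree}
    (hT : M.HasCornerAfterDelete p x T) (hx : p x = true) :
    M.HasCornerAfterDelete p (M.next x) T :=
  fun z hz => hT z (.step hx hz)

theorem HasCornerAfterDelete.concat {x : M.HalfEdge} {t T : PlaneTree}
    (hT : M.HasCornerAfterDelete p x T) (hp : p x = false) (hx : M.isHead x = false)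
    (hmate : M.mate x ≠ x) (hpmate : p (M.mate x) = false)
    (ht : (M.delete p).explode.HasShape
      (⟨M.mate x, hpmate⟩ : {x : M.HalfEdge // p x = false}) t) :
    M.HasCornerAfterDelete p (M.next x) (.σ t T) := by
  intro z hz
  let x' : (M.delete p).HalfEdge := ⟨x, hp⟩
  obtain rfl : (M.delete p).next x' = z := Subtype.ext ((firstKept_delete_next x').unique hz)
  have mate_x' := delete_mate_of_kept (x := x') hpmate
  refine .concat (hT x' (.refl hp)) hx (fun h => hmate ?_) (mate_x' ▸ ht)
  exact congrArg Subtype.val (mate_x'.symm.trans h)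

theorem HasCornerAfterDelete.hasShape {h : M.HalfEdge} {T : PlaneTree}
    (hT : M.HasCornerAfterDelete p h T) (hp : p h = false) (hh : M.isHead h = true) :
    (M.delete p).explode.HasShape (⟨h, hp⟩ : {x : M.HalfEdge // p x = false}) T :=
  (hT ⟨h, hp⟩ (.refl hp)).hasShape hh

end Delete

/-! # Climbing maps -/

/-- The function `f` increases from each tail to the next half-edge around its vertex, and from
the head of each edge to the half-edge that follows the tail. Hence every half-edge climbs to a
head without tail. -/
structure Climbing (M : OrientedMap) (f : M.HalfEdge → ℕ) : Prop where
  lt_next : ∀ x, M.isHead x = false → f x < f (M.next x)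
  mate_lt_next : ∀ x, M.isHead x = false → f (M.mate x) < f (M.next x)

theorem Climbing.delete {f : M.HalfEdge → ℕ} {p : M.HalfEdge → Bool} (hf : M.Climbing f)
    (hp : ∀ x, p x = true → M.isHead x = false) : (M.delete p).Climbing (fun x => f x.1) := by
  have le_of_firstKept {y z : M.HalfEdge} (h : FirstKept M.next p y z) : f y ≤ f z := by
    induction h with
    | refl => exact le_rfl
    | step hx _ ih => exact (hf.lt_next _ (hp _ hx)).le.trans ih
  refine ⟨fun x hx => (hf.lt_next x.1 hx).trans_le (le_of_firstKept (firstKept_delete_next x)),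
    fun x hx => ?_⟩
  refine lt_of_lt_of_le ?_ (le_of_firstKept (firstKept_delete_next x))
  cases hmate : p (M.mate x.1) with
  | false => rw [delete_mate_of_kept hmate]; exact hf.mate_lt_next x.1 hx
  | true => rw [delete_mate_of_deleted hmate]; exact hf.lt_next x.1 hx

theorem Climbing.isHead_firstHead {f : M.HalfEdge → ℕ} (hf : M.Climbing f) (x : M.HalfEdge) :
    M.isHead (M.firstHead x) = true := by
  refine OrientedMap.isHead_firstHead ?_
  by_contra! htails
  have hmono : StrictMono fun n => f ((M.next ^ n) x) :=
    strictMono_nat_of_lt_succ fun n => by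
      rw [pow_succ', Equiv.Perm.mul_apply]
      exact hf.lt_next _ (by simpa using htails n)
  obtain ⟨k, hk, hkx⟩ := exists_return M.next x
  simpa [hkx] using hmono hk

theorem Climbing.exists_root {f : M.HalfEdge → ℕ} (hf : M.Climbing f) (x : M.HalfEdge) :
    ∃ r, M.isHead r = true ∧ M.mate r = r ∧ M.explode.Joined r x := by
  have climb_next {x : M.HalfEdge} (hx : M.isHead x = false) (r) :
      M.explode.Joined r (M.next x) → M.explode.Joined r x := by
    rw [← explode_next_of_tail hx (hf.isHead_firstHead x)]
    exact (M.explode.joined_next_iff r x).mp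
  obtain ⟨b, hb⟩ := (Set.finite_range f).bddAbove
  induction hn : b - f x using Nat.strong_induction_on generalizing x with
  | _ n ih =>
    have ih_of_lt {y : M.HalfEdge} (hy : f x < f y) :
        ∃ r, M.isHead r = true ∧ M.mate r = r ∧ M.explode.Joined r y :=
      ih _ (by have := hb ⟨y, rfl⟩; omega) y rfl
    cases hx : M.isHead x with
    | false =>
      obtain ⟨r, hr, hmate, hrx⟩ := ih_of_lt (hf.lt_next x hx)
      exact ⟨r, hr, hmate, climb_next hx r hrx⟩
    | true =>
      by_cases hmate : M.mate x = x
      · exact ⟨x, hx, hmate, .refl x⟩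
      have hy : M.isHead (M.mate x) = false := by simp [M.isHead_mate x hmate, hx]
      obtain ⟨r, hr, hr_mate, hrx⟩ :=
        ih_of_lt (M.mate_mate x ▸ hf.mate_lt_next (M.mate x) hy)
      exact ⟨r, hr, hr_mate, (M.explode.joined_mate_iff r x).mp (climb_next hy r hrx)⟩

/-- Each vertex has exactly one head. -/
def HasUniqueHeads (M : OrientedMap) : Prop :=
  ∀ x, ∃! h, M.isHead h = true ∧ M.next.SameCycle h x

theorem sameCycle_firstHead (hM : ∀ x, M.isHead (M.firstHead x) = true) (x : M.HalfEdge) :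
    M.explode.next.SameCycle (M.firstHead x) x := by
  have sameCycle_of_pow (k : ℕ) (x : M.HalfEdge) (hk : M.isHead ((M.next ^ k) x) = true) :
      (firstReturn M.next M.firstHead).SameCycle (M.firstHead x) x := by
    induction k generalizing x with
    | zero => rw [firstHead_of_isHead (x := x) hk]
    | succ k ih =>
      cases hx : M.isHead x with
      | true => rw [firstHead_of_isHead hx]
      | false =>
        have hnext : firstReturn M.next M.firstHead x = M.next x := explode_next_of_tail hx (hM x)
        rw [← firstHead_next_of_tail hx (hM x), ← Equiv.Perm.sameCycle_apply_right, hnext]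
        exact ih (M.next x) (by rwa [pow_succ, Equiv.Perm.mul_apply] at hk)
  exact sameCycle_of_pow _ x (hM x)

theorem hasUniqueHeads_explode (hM : ∀ x, M.isHead (M.firstHead x) = true) :
    M.explode.HasUniqueHeads := by
  refine fun x => ⟨M.firstHead x, ⟨hM x, sameCycle_firstHead hM x⟩, ?_⟩
  rintro h ⟨hh, hhx⟩
  exact (firstHead_of_isHead (M := M) (x := h) hh).symm.trans
    (apply_eq_of_sameCycle (f := M.firstHead) firstHead_explode_next hhx)

/-! # Components and trees -/

theorem component_next_pow_val (r : M.HalfEdge) (k : ℕ) (x : (M.component r).HalfEdge) :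
    (((M.component r).next ^ k) x).1 = (M.next ^ k) x.1 := by
  induction k generalizing x with
  | zero => rfl
  | succ k ih =>
    rw [pow_succ, Equiv.Perm.mul_apply, ih, pow_succ, Equiv.Perm.mul_apply]
    rfl

theorem HasShape.component {r y : M.HalfEdge} {t : PlaneTree} (h : M.HasShape y t)
    (hy : M.Joined r y) : (M.component r).HasShape ⟨y, hy⟩ t := by
  induction h with
  | node y ts degree edges _ ih =>
    have hpow (k : ℕ) : ((M.component r).next ^ k) ⟨y, hy⟩ =
        ⟨(M.next ^ k) y, component_next_pow_val r k ⟨y, hy⟩ ▸ Subtype.prop _⟩ :=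
      Subtype.ext (component_next_pow_val r k _)
    refine .node _ ts ?_ (fun i hi e => ?_) (fun i hi => ?_)
    · rw [← degree]
      refine Function.minimalPeriod_eq_minimalPeriod_iff.mpr fun n => ?_
      change (M.component r).next^[n] _ = _ ↔ M.next^[n] y = y
      rw [Equiv.Perm.iterate_eq_pow, Equiv.Perm.iterate_eq_pow, hpow]
      exact Subtype.ext_iff
    · rw [hpow] at e
      exact edges i hi (congrArg Subtype.val e)
    · rw [hpow]
      exact ih i hi _

theorem Joined.component {r x y : M.HalfEdge} (h : M.Joined x y) (hx : M.Joined r x)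
    (hy : M.Joined r y) : (M.component r).Joined ⟨x, hx⟩ ⟨y, hy⟩ := by
  unfold Joined at h
  induction h with
  | rel x y h => exact .rel _ _ (h.imp Subtype.ext Subtype.ext)
  | refl x => exact .refl _
  | symm x y _ ih => exact .symm _ _ (ih hy hx)
  | trans x y z hxy _ ih ih' =>
    exact .trans _ _ _ (ih hx (.trans _ _ _ hx hxy)) (ih' (.trans _ _ _ hx hxy) hy)

theorem joined_of_sameCycle {x y : M.HalfEdge} (h : M.next.SameCycle x y) : M.Joined x y := by
  obtain ⟨n, rfl⟩ := h.exists_nat_pow_eq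
  induction n with
  | zero => exact .refl x
  | succ n ih =>
    rw [pow_succ', Equiv.Perm.mul_apply, joined_next_iff]
    exact ih ⟨n, rfl⟩

theorem HasUniqueHeads.component (hM : M.HasUniqueHeads) (r : M.HalfEdge) :
    (M.component r).HasUniqueHeads := by
  intro x
  obtain ⟨h, ⟨hh, hhx⟩, hunique⟩ := hM x.1
  have hrh : M.Joined r h := .trans _ _ _ x.2 (joined_of_sameCycle hhx.symm)
  have sameCycle_iff (y z : (M.component r).HalfEdge) :
      (M.component r).next.SameCycle y z ↔ M.next.SameCycle y.1 z.1 :=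
    Equiv.Perm.sameCycle_subtypePerm (h := M.joined_next_iff r)
  refine ⟨⟨h, hrh⟩, ⟨hh, (sameCycle_iff _ x).mpr hhx⟩, ?_⟩
  rintro g ⟨hg, hgx⟩
  exact Subtype.ext (hunique g.1 ⟨hg, (sameCycle_iff g x).mp hgx⟩)

theorem HasUniqueHeads.numVertices_eq (hM : M.HasUniqueHeads) :
    M.numVertices = Nat.card {x : M.HalfEdge // M.isHead x = true} := by
  refine (Nat.card_eq_of_bijective
    (fun x => Quotient.mk (Equiv.Perm.SameCycle.setoid M.next) x.1) ⟨fun x y hxy => ?_, ?_⟩).symm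
  · exact Subtype.ext ((hM y.1).unique ⟨x.2, Quotient.exact hxy⟩ ⟨y.2, .refl _ _⟩)
  · refine Quotient.ind fun x => ?_
    obtain ⟨h, ⟨hh, hhx⟩, -⟩ := hM x
    exact ⟨⟨h, hh⟩, Quotient.sound hhx⟩

theorem card_heads_eq_numEdges_add_one {r : M.HalfEdge} (hr : M.isHead r = true)
    (hroot : ∀ x, M.mate x = x ↔ x = r) :
    Nat.card {x : M.HalfEdge // M.isHead x = true} = M.numEdges + 1 := by
  have hedges : {x | M.isHead x = true} \ {r} = {x | M.isHead x = true ∧ M.mate x ≠ x} := by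
    ext x
    simp [hroot]
  have hcard := Set.ncard_sdiff_singleton_add_one (s := {x | M.isHead x = true}) (a := r) hr
  rw [hedges] at hcard
  exact hcard.symm

/-- The border of a single face, followed from the root `r`, meets every half-edge of `S`; the set
`S` is closed under `next` and, except at `r`, under `mate`. -/
structure IsToured (M : OrientedMap) (r : M.HalfEdge) (S : Set M.HalfEdge) : Prop where
  root_mem : r ∈ S
  next_mem : ∀ y ∈ S, M.next y ∈ S
  mate_ne : ∀ y ∈ S, y ≠ r → M.mate y ≠ y
  mate_mem : ∀ y ∈ S, y ≠ r → M.mate y ∈ S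
  sameCycle : ∀ y ∈ S, (M.next * M.mate).SameCycle y r

theorem IsToured.sameCycle_mate {x : M.HalfEdge} {S : Set M.HalfEdge}
    (hS : M.IsToured (M.mate x) S) : (M.next * M.mate).SameCycle x (M.mate x) := by
  rw [← Equiv.Perm.sameCycle_apply_left]
  exact hS.sameCycle _ (hS.next_mem _ hS.root_mem)

theorem IsToured.sameCycle_next {x : M.HalfEdge} {S : Set M.HalfEdge}
    (hS : M.IsToured (M.mate x) S) : (M.next * M.mate).SameCycle x (M.next x) := by
  refine hS.sameCycle_mate.trans ?_
  rw [← Equiv.Perm.sameCycle_apply_left, Equiv.Perm.mul_apply, M.mate_mate]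

theorem sameCycle_pow_root_of_isToured {r : M.HalfEdge} {n : ℕ} {S : ℕ → Set M.HalfEdge}
    (degree : Function.minimalPeriod M.next r = n + 1)
    (hS : ∀ i < n, M.IsToured (M.mate ((M.next ^ (i + 1)) r)) (S i)) {i : ℕ} (hi : i ≤ n) :
    (M.next * M.mate).SameCycle ((M.next ^ (i + 1)) r) r := by
  induction hi using Nat.decreasingInduction with
  | self => rw [← degree, ← Equiv.Perm.iterate_eq_pow, Function.iterate_minimalPeriod]
  | of_succ i hi ih =>
    refine (hS i hi).sameCycle_next.trans ?_
    rwa [← Equiv.Perm.mul_apply, ← pow_succ']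

theorem IsToured.node {r : M.HalfEdge} {n : ℕ} {S : ℕ → Set M.HalfEdge}
    (degree : Function.minimalPeriod M.next r = n + 1)
    (edges : ∀ i < n, M.mate ((M.next ^ (i + 1)) r) ≠ (M.next ^ (i + 1)) r)
    (hS : ∀ i < n, M.IsToured (M.mate ((M.next ^ (i + 1)) r)) (S i)) :
    M.IsToured r ({y | M.next.SameCycle r y} ∪ ⋃ i < n, S i) := by
  have mem_iff (y : M.HalfEdge) : y ∈ {y | M.next.SameCycle r y} ∪ ⋃ i < n, S i ↔
      M.next.SameCycle r y ∨ ∃ i < n, y ∈ S i := by simp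
  have eq_or_eq_pow {y : M.HalfEdge} (hy : M.next.SameCycle r y) :
      y = r ∨ ∃ i < n, y = (M.next ^ (i + 1)) r := by
    simpa [degree] using eq_or_exists_pow_of_sameCycle hy
  refine ⟨(mem_iff r).mpr (.inl (.refl _ _)), fun y hy => ?_, fun y hy hyr => ?_,
    fun y hy hyr => ?_, fun y hy => ?_⟩ <;> rw [mem_iff] at hy
  · rw [mem_iff]
    exact hy.imp Equiv.Perm.sameCycle_apply_right.mpr
      fun ⟨i, hi, hyi⟩ => ⟨i, hi, (hS i hi).next_mem y hyi⟩
  · rcases hy with hy | ⟨i, hi, hyi⟩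
    · obtain ⟨i, hi, rfl⟩ := (eq_or_eq_pow hy).resolve_left hyr
      exact edges i hi
    · by_cases hroot : y = M.mate ((M.next ^ (i + 1)) r)
      · rw [hroot, M.mate_mate]
        exact (edges i hi).symm
      · exact (hS i hi).mate_ne y hyi hroot
  · rw [mem_iff]
    rcases hy with hy | ⟨i, hi, hyi⟩
    · obtain ⟨i, hi, rfl⟩ := (eq_or_eq_pow hy).resolve_left hyr
      exact .inr ⟨i, hi, (hS i hi).root_mem⟩
    · by_cases hroot : y = M.mate ((M.next ^ (i + 1)) r)
      · rw [hroot, M.mate_mate]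
        exact .inl ⟨(i + 1 : ℕ), rfl⟩
      · exact .inr ⟨i, hi, (hS i hi).mate_mem y hyi hroot⟩
  · rcases hy with hy | ⟨i, hi, hyi⟩
    · rcases eq_or_eq_pow hy with rfl | ⟨i, hi, rfl⟩
      · rfl
      · exact sameCycle_pow_root_of_isToured degree hS hi.le
    · exact ((hS i hi).sameCycle y hyi).trans
        ((hS i hi).sameCycle_mate.symm.trans (sameCycle_pow_root_of_isToured degree hS hi.le))

theorem HasShape.exists_isToured {r : M.HalfEdge} {t : PlaneTree} (h : M.HasShape r t) :
    ∃ S, M.IsToured r S := by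
  induction h with
  | node r ts degree edges _ ih =>
    choose! S hS using ih
    exact ⟨_, .node degree edges hS⟩

theorem mem_of_joined {S : Set M.HalfEdge} (hnext : ∀ y ∈ S, M.next y ∈ S)
    (hmate : ∀ y ∈ S, M.mate y ∈ S) {x y : M.HalfEdge} (h : M.Joined x y) (hx : x ∈ S) :
    y ∈ S := by
  have next_mem_iff (y : M.HalfEdge) : M.next y ∈ S ↔ y ∈ S := by
    refine ⟨fun hy => ?_, hnext y⟩
    simpa using Equiv.Perm.perm_symm_on_of_perm_on_finite hnext hy
  have mate_mem_iff (y : M.HalfEdge) : M.mate y ∈ S ↔ y ∈ S :=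
    ⟨fun hy => M.mate_mate y ▸ hmate _ hy, hmate y⟩
  unfold Joined at h
  suffices hiff : x ∈ S ↔ y ∈ S from hiff.mp hx
  clear hx
  induction h with
  | rel x y h =>
    rcases h with rfl | rfl
    exacts [(next_mem_iff x).symm, (mate_mem_iff x).symm]
  | refl => rfl
  | symm x y _ ih => exact ih.symm
  | trans x y z _ _ ih ih' => exact ih.trans ih'

theorem IsToured.mem_of_joined {r x : M.HalfEdge} {S : Set M.HalfEdge} (hS : M.IsToured r S)
    (hmate : M.mate r = r) (h : M.Joined r x) : x ∈ S := by
  refine OrientedMap.mem_of_joined hS.next_mem (fun y hy => ?_) h hS.root_mem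
  by_cases hyr : y = r
  · rwa [hyr, hmate, ← hyr]
  · exact hS.mate_mem y hy hyr

theorem HasShape.isTree {r : M.HalfEdge} {t : PlaneTree} (h : M.HasShape r t)
    (hM : M.HasUniqueHeads) (hconn : ∀ x, M.Joined r x) (hr : M.isHead r = true)
    (hmate : M.mate r = r) : M.IsTree r := by
  obtain ⟨S, hS⟩ := h.exists_isToured
  have mem (x : M.HalfEdge) : x ∈ S := hS.mem_of_joined hmate (hconn x)
  have hroot (x : M.HalfEdge) : M.mate x = x ↔ x = r :=
    ⟨fun hx => by_contra fun hxr => hS.mate_ne x (mem x) hxr hx, fun hx => hx ▸ hmate⟩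
  have hfaces : M.numFaces = 1 := by
    refine Nat.card_eq_one_iff_exists.mpr ⟨Quotient.mk _ r, ?_⟩
    exact Quotient.ind fun x => Quotient.sound (hS.sameCycle x (mem x))
  refine ⟨hconn, hroot, ?_, hfaces⟩
  rw [hM.numVertices_eq, card_heads_eq_numEdges_add_one hr hroot, hfaces]

theorem HasShape.isTreeAt {r : M.HalfEdge} {t : PlaneTree} (h : M.HasShape r t)
    (hM : M.HasUniqueHeads) (hr : M.isHead r = true) (hmate : M.mate r = r) : M.IsTreeAt r t := by
  have hshape : (M.component r).HasShape (M.componentRoot r) t := h.component _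
  exact ⟨hshape.isTree (hM.component r) (fun x => Joined.component x.2 _ _) hr (Subtype.ext hmate),
    hshape⟩

theorem IsTreeAt.eq_of_joined {r r' : M.HalfEdge} {t : PlaneTree} (h : M.IsTreeAt r t)
    (hr' : M.Joined r r') (hmate : M.mate r' = r') : r' = r :=
  congrArg Subtype.val ((h.1.root ⟨r', hr'⟩).mp (Subtype.ext hmate))

end OrientedMap

/-! # Half-edges of the prefix-map -/

section HalfEdge

variable {w : List Letter} {x y : HalfEdges w} {i n : ℕ} {c d l : Letter}

/-- The half-edge encountered when the letter at position `n` of `w⁺` is written; for `n = |w⁺|`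
it is the root. -/
def halfEdge (w : List Letter) (n : ℕ) : HalfEdges w := Fin.ofNat _ (n + 1)

/-- The position in `w⁺` of the letter written at `x`. It is `|w⁺|` for the root, which
closes the tour. -/
def position (w : List Letter) (x : HalfEdges w) : ℕ := (x - 1).val

theorem halfEdge_succ (n : ℕ) : halfEdge w n + 1 = halfEdge w (n + 1) :=
  Fin.ext (by simp [halfEdge, Fin.val_add])

theorem halfEdge_length : halfEdge w (plus w).length = 0 := by
  rw [halfEdge, Fin.ofNat_self]

theorem halfEdge_val (hn : n < (plus w).length) : (halfEdge w n).val = n + 1 :=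
  Nat.mod_eq_of_lt (by omega)

theorem position_halfEdge (hn : n ≤ (plus w).length) : position w (halfEdge w n) = n := by
  have : halfEdge w n = Fin.ofNat _ n + 1 := Fin.ext (by simp [halfEdge, Fin.val_add])
  rw [position, this, add_sub_cancel_right, Fin.val_ofNat, Nat.mod_eq_of_lt (by omega)]

theorem exists_halfEdge_eq (x : HalfEdges w) : ∃ n ≤ (plus w).length, halfEdge w n = x := by
  obtain ⟨n, hn⟩ := x
  rcases n with - | n
  · exact ⟨_, le_rfl, halfEdge_length⟩
  · exact ⟨n, by omega, Fin.ext (halfEdge_val (by omega))⟩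

theorem letterAt_halfEdge (hn : n ≤ (plus w).length) :
    letterAt w (halfEdge w n) = (plus w)[n]? := by
  rcases hn.eq_or_lt with rfl | hn
  · simp [halfEdge_length, letterAt]
  · simp [letterAt, halfEdge_val hn]

theorem letterAt_halfEdge_of_eq_some (h : (plus w)[n]? = some l) :
    letterAt w (halfEdge w n) = some l :=
  (letterAt_halfEdge (lt_length_of_getElem?_eq_some h).le).trans h

theorem isHead_halfEdge (hn : n ≤ (plus w).length) :
    (prefixMap w).isHead (halfEdge w n) = headLetter (plus w)[n]? :=
  congrArg headLetter (letterAt_halfEdge hn)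

theorem isHead_halfEdge_of_eq_some (h : (plus w)[n]? = some l) :
    (prefixMap w).isHead (halfEdge w n) = headLetter (some l) :=
  congrArg headLetter (letterAt_halfEdge_of_eq_some h)

theorem pos_and_nonPaired_halfEdge_iff (hn : n ≤ (plus w).length) :
    0 < (halfEdge w n).val ∧ NonPaired c d w ((halfEdge w n).val - 1) ↔ NonPaired c d w n := by
  rcases hn.eq_or_lt with rfl | hn
  · simp [halfEdge_length, NonPaired, length_le_length_plus]
  · simp [halfEdge_val hn]

theorem isActiveTail_halfEdge_iff (hn : n ≤ (plus w).length) :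
    isActiveTail w (halfEdge w n) = true ↔ NonPaired .a .aBar w n :=
  decide_eq_true_iff.trans (pos_and_nonPaired_halfEdge_iff hn)

theorem isDanglingHead_halfEdge_iff (hn : n ≤ (plus w).length) :
    isDanglingHead w (halfEdge w n) = true ↔ NonPaired .b .bBar w n :=
  decide_eq_true_iff.trans (pos_and_nonPaired_halfEdge_iff hn)

theorem NonPaired.getElem?_plus (h : NonPaired c d w n) : (plus w)[n]? = some c :=
  getElem?_plus_of_eq_some h.1

theorem letterAt_of_isActiveTail (h : isActiveTail w x = true) : letterAt w x = some .a := by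
  obtain ⟨n, hn, rfl⟩ := exists_halfEdge_eq x
  exact letterAt_halfEdge_of_eq_some ((isActiveTail_halfEdge_iff hn).mp h).getElem?_plus

theorem letterAt_of_isDanglingHead (h : isDanglingHead w x = true) : letterAt w x = some .b := by
  obtain ⟨n, hn, rfl⟩ := exists_halfEdge_eq x
  exact letterAt_halfEdge_of_eq_some ((isDanglingHead_halfEdge_iff hn).mp h).getElem?_plus

theorem isHead_of_isActiveTail (h : isActiveTail w x = true) : (prefixMap w).isHead x = false :=
  congrArg headLetter (letterAt_of_isActiveTail h)

theorem isActiveTail_eq_false_of_isHead (h : (prefixMap w).isHead x = true) :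
    isActiveTail w x = false :=
  Bool.eq_false_of_not_eq_true fun h' => by simp [isHead_of_isActiveTail h'] at h

/-! # Edges of the prefix-map -/

theorem partner_eq {m : ℕ} {R : Fin m → Fin m → Prop} [DecidableRel R]
    (hR : ∀ x y z, R x y → R x z → y = z) {x y : Fin m} (h : R x y) : partner R x = y := by
  rcases partner_spec R x with h' | ⟨h', -⟩
  · exact hR _ _ _ h' h
  · exact absurd h (h' y)

theorem partner_eq_self {m : ℕ} {R : Fin m → Fin m → Prop} [DecidableRel R] {x : Fin m}
    (h : ∀ y, ¬ R x y) : partner R x = x :=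
  (partner_spec R x).elim (fun h' => absurd h' (h _)) And.right

theorem Paired.linked (h : Paired c d (plus w) i n) :
    Linked c d w (halfEdge w i) (halfEdge w n) := by
  rw [Linked, halfEdge_val h.lt_length, halfEdge_val (h.1.trans h.lt_length)]
  exact ⟨i.succ_pos, n.succ_pos, .inl h⟩

theorem treeMate_eq (h : Linked .a .aBar w x y) : treeMate w x = y :=
  partner_eq (fun _ _ _ => Linked.unique (by decide)) h

theorem treeMate_eq_self (ha : letterAt w x ≠ some .a) (haBar : letterAt w x ≠ some .aBar) :
    treeMate w x = x :=
  partner_eq_self fun _ h => h.letterAt.elim (fun h => ha h.1) (fun h => haBar h.1)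

theorem treeMate_treeMate (x : HalfEdges w) : treeMate w (treeMate w x) = x :=
  partner_partner (Linked .a .aBar w) (fun _ _ h => h.symm)
    (fun _ _ _ => Linked.unique (by decide)) x

theorem mate_eq (h : LinkedAny w x y) : (prefixMap w).mate x = y :=
  partner_eq LinkedAny.unique h

theorem mate_eq_self (h : ∀ y, ¬ LinkedAny w x y) : (prefixMap w).mate x = x :=
  partner_eq_self h

theorem next_apply (x : HalfEdges w) : (prefixMap w).next x = (treeMate w x + 1 : HalfEdges w) :=
  finRotate_apply _

theorem Paired.next_halfEdge_left (h : Paired .a .aBar (plus w) i n) :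
    (prefixMap w).next (halfEdge w i) = halfEdge w (n + 1) := by
  rw [next_apply, treeMate_eq h.linked]
  exact halfEdge_succ n

theorem Paired.next_halfEdge_right (h : Paired .a .aBar (plus w) i n) :
    (prefixMap w).next (halfEdge w n) = halfEdge w (i + 1) := by
  rw [next_apply, treeMate_eq h.linked.symm]
  exact halfEdge_succ i

theorem next_halfEdge_of_ne (hn : n ≤ (plus w).length) (ha : (plus w)[n]? ≠ some .a)
    (haBar : (plus w)[n]? ≠ some .aBar) :
    (prefixMap w).next (halfEdge w n) = halfEdge w (n + 1) := by
  rw [← letterAt_halfEdge hn] at ha haBar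
  rw [next_apply, treeMate_eq_self ha haBar]
  exact halfEdge_succ n

variable (hw : IsPrefixShuffle w)
include hw

theorem exists_paired_of_a (h : (plus w)[i]? = some .a) : ∃ n, Paired .a .aBar (plus w) i n := by
  obtain ⟨n, -, hn⟩ := exists_paired_of_notMem_pending (c := .a) (d := .aBar) (by decide)
    (lt_length_of_getElem?_eq_some h) h (by simp [pending_length_plus hw])
  exact ⟨n, hn⟩

theorem exists_paired_of_aBar (h : (plus w)[n]? = some .aBar) :
    ∃ i, Paired .a .aBar (plus w) i n :=
  exists_paired_of_close (by decide) (isPrefixShuffle_plus hw).count_aBar_le h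

theorem exists_paired_of_bBar (h : (plus w)[n]? = some .bBar) :
    ∃ i, Paired .b .bBar (plus w) i n :=
  exists_paired_of_close (by decide) (isPrefixShuffle_plus hw).count_bBar_le h

theorem climbing_prefixMap : (prefixMap w).Climbing (position w) := by
  have tail_spec (x : HalfEdges w) (hx : (prefixMap w).isHead x = false) :
      position w x < position w ((prefixMap w).next x) ∧
        position w ((prefixMap w).mate x) < position w ((prefixMap w).next x) := by
    obtain ⟨n, hn, rfl⟩ := exists_halfEdge_eq x
    rw [isHead_halfEdge hn] at hx
    rcases hl : (plus w)[n]? with - | _ | _ | _ | _ <;> rw [hl] at hx <;> try cases hx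
    · obtain ⟨m, hm⟩ := exists_paired_of_a hw hl
      have := hm.1
      rw [hm.next_halfEdge_left, mate_eq (.inl hm.linked), position_halfEdge hn,
        position_halfEdge hm.lt_length.le, position_halfEdge (n := m + 1) hm.lt_length]
      omega
    · obtain ⟨i, hi⟩ := exists_paired_of_bBar hw hl
      have := hi.1
      rw [next_halfEdge_of_ne hn (by simp [hl]) (by simp [hl]), mate_eq (.inr hi.linked.symm),
        position_halfEdge hn, position_halfEdge (this.le.trans hn),
        position_halfEdge (n := n + 1) hi.lt_length]
      omega
  exact ⟨fun x hx => (tail_spec x hx).1, fun x hx => (tail_spec x hx).2⟩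

end HalfEdge

/-! # Roots of the prefix-forest -/

section Roots

variable {w : List Letter} {x : HalfEdges w} {n : ℕ} {c d : Letter}

theorem Paired.isActiveTail_halfEdge_iff {i : ℕ} (h : Paired .a .aBar (plus w) i n) :
    isActiveTail w (halfEdge w i) = true ↔ w.length ≤ n := by
  have hi := lt_length_of_getElem?_plus h.2.1 (by decide)
  rw [PrefixShuffle.isActiveTail_halfEdge_iff (hi.le.trans (length_le_length_plus w))]
  constructor
  · intro hi'
    by_contra! hn
    exact hi'.2 n (List.mem_range.mpr hn) ((paired_plus_iff hn).mp h)
  · refine fun hn => ⟨(getElem?_plus_of_lt hi).symm.trans h.2.1, fun j hj hij => ?_⟩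
    have hj := List.mem_range.mp hj
    have := h.unique_right (by decide) ((paired_plus_iff hj).mpr hij)
    omega

theorem Linked.exists_paired (hcd : c ≠ d) {y : HalfEdges w} (h : Linked c d w (halfEdge w n) y)
    (hl : (plus w)[n]? = some c) : ∃ m, Paired c d (plus w) n m := by
  have hval := halfEdge_val (lt_length_of_getElem?_eq_some hl)
  obtain ⟨-, -, hp⟩ := h
  rw [hval, Nat.add_sub_cancel] at hp
  rcases hp with hp | hp
  · exact ⟨_, hp⟩
  · exact absurd (Option.some_inj.mp (hl.symm.trans hp.2.2.1)) hcd

theorem mate_halfEdge_eq_self_iff (hl : (plus w)[n]? = some .b) :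
    (prefixMap w).mate (halfEdge w n) = halfEdge w n ↔ NonPaired .b .bBar w n := by
  have letter := letterAt_halfEdge_of_eq_some hl
  constructor
  · refine fun h => ⟨by rwa [← getElem?_plus_of_lt (lt_length_of_getElem?_plus hl (by decide))],
      fun j hj hp => ?_⟩
    have linked := ((paired_plus_iff (List.mem_range.mp hj)).mpr hp).linked
    rw [mate_eq (.inr linked)] at h
    rw [h] at linked
    rcases linked.letterAt with h' | h' <;> simp [letter] at h'
  · refine fun h => mate_eq_self fun y hy => ?_
    rcases hy with hy | hy
    · rcases hy.letterAt with h' | h' <;> simp [letter] at h'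
    · obtain ⟨m, hm⟩ := hy.exists_paired (by decide) hl
      have hm_lt := lt_length_of_getElem?_plus hm.2.2.1 (by decide)
      exact h.2 m (List.mem_range.mpr hm_lt) ((paired_plus_iff hm_lt).mp hm)

theorem mate_zero : (prefixMap w).mate (0 : HalfEdges w) = (0 : HalfEdges w) :=
  mate_eq_self fun _ h => h.elim (fun h => h.1.false) (fun h => h.1.false)

theorem mem_danglingHeads : x ∈ danglingHeads w ↔ isDanglingHead w x = true := by
  simp only [danglingHeads, List.mem_filter, List.mem_finRange, true_and]

theorem mem_rootingHeads : x ∈ rootingHeads w ↔ x = 0 ∨ isActiveTail w (treeMate w x) = true := by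
  simp only [rootingHeads, List.mem_cons, List.mem_map, List.mem_filter, List.mem_finRange,
    true_and]
  refine or_congr_right ⟨?_, fun h => ⟨_, h, treeMate_treeMate x⟩⟩
  rintro ⟨y, hy, rfl⟩
  rwa [treeMate_treeMate]

variable (hw : IsPrefixShuffle w)
include hw

theorem letterAt_treeMate (h : letterAt w x = some .a) :
    letterAt w (treeMate w x) = some .aBar := by
  obtain ⟨n, hn, rfl⟩ := exists_halfEdge_eq x
  rw [letterAt_halfEdge hn] at h
  obtain ⟨m, hm⟩ := exists_paired_of_a hw h
  rw [treeMate_eq hm.linked]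
  exact letterAt_halfEdge_of_eq_some hm.2.2.1

theorem isHead_and_mate_eq_self_iff :
    (prefixMap w).isHead x = true ∧ (prefixMap w).mate x = x ↔
      x = 0 ∨ isDanglingHead w x = true := by
  obtain ⟨n, hn, rfl⟩ := exists_halfEdge_eq x
  rw [isHead_halfEdge hn, isDanglingHead_halfEdge_iff hn]
  constructor
  · rintro ⟨hhead, hmate⟩
    rcases hl : (plus w)[n]? with - | _ | _ | _ | _ <;> rw [hl] at hhead <;> try cases hhead
    · obtain rfl : n = (plus w).length := hn.antisymm (List.getElem?_eq_none_iff.mp hl)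
      exact .inl halfEdge_length
    · obtain ⟨i, hi⟩ := exists_paired_of_aBar hw hl
      have hpos := congrArg (position w) ((mate_eq (.inl hi.linked.symm)).symm.trans hmate)
      rw [position_halfEdge (hi.1.le.trans hn), position_halfEdge hn] at hpos
      exact absurd hpos hi.1.ne
    · exact .inr ((mate_halfEdge_eq_self_iff hl).mp hmate)
  · rintro (h | h)
    · have letter := letterAt_halfEdge hn
      rw [h] at letter ⊢
      exact ⟨congrArg headLetter letter.symm, mate_zero⟩
    · have hl := h.getElem?_plus
      exact ⟨congrArg headLetter hl, (mate_halfEdge_eq_self_iff hl).mpr h⟩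

theorem mate_of_isActiveTail (h : isActiveTail w x = true) :
    (prefixMap w).mate x = treeMate w x := by
  obtain ⟨n, hn, rfl⟩ := exists_halfEdge_eq x
  obtain ⟨m, hm⟩ := exists_paired_of_a hw ((isActiveTail_halfEdge_iff hn).mp h).getElem?_plus
  rw [mate_eq (.inl hm.linked), treeMate_eq hm.linked]

theorem isActiveTail_mate_iff :
    isActiveTail w ((prefixMap w).mate x) = true ↔ isActiveTail w (treeMate w x) = true := by
  constructor <;> intro h <;> have heq := mate_of_isActiveTail hw h
  · have hx : x = treeMate w ((prefixMap w).mate x) := ((prefixMap w).mate_mate x).symm.trans heq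
    rw [hx]
    exact (congrArg (isActiveTail w) (treeMate_treeMate _)).trans h
  · have hx : (prefixMap w).mate (treeMate w x) = x := heq.trans (treeMate_treeMate x)
    rw [← hx]
    exact (congrArg (isActiveTail w) ((prefixMap w).mate_mate _)).trans h

theorem mem_heads_iff : x ∈ danglingHeads w ++ rootingHeads w ↔ (prefixMap w).isHead x = true ∧
    ((prefixMap w).mate x = x ∨ isActiveTail w ((prefixMap w).mate x) = true) := by
  have isHead_of_active (h : isActiveTail w (treeMate w x) = true) :
      (prefixMap w).isHead x = true := by
    have letter := letterAt_treeMate hw (letterAt_of_isActiveTail h)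
    rw [treeMate_treeMate] at letter
    exact congrArg headLetter letter
  rw [List.mem_append, mem_danglingHeads, mem_rootingHeads, isActiveTail_mate_iff hw, and_or_left,
    isHead_and_mate_eq_self_iff hw, and_iff_right_of_imp isHead_of_active]
  tauto

theorem nodup_heads : (danglingHeads w ++ rootingHeads w).Nodup := by
  have rooting_nodup : (rootingHeads w).Nodup := by
    refine List.nodup_cons.mpr ⟨fun h => ?_,
      ((List.nodup_finRange _).filter _).map (treeMate w).injective⟩
    obtain ⟨y, hy, hy0⟩ := List.mem_map.mp h
    have letter := letterAt_treeMate hw (letterAt_of_isActiveTail (List.mem_filter.mp hy).2)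
    simp [hy0, letterAt] at letter
  refine ((List.nodup_finRange _).filter _).append rooting_nodup fun x hx hx' => ?_
  have letter := letterAt_of_isDanglingHead (mem_danglingHeads.mp hx)
  rcases mem_rootingHeads.mp hx' with rfl | hact
  · simp [letterAt] at letter
  · have letter' := letterAt_treeMate hw (letterAt_of_isActiveTail hact)
    simp [treeMate_treeMate, letter] at letter'

end Roots

/-! # The trees of the prefix-forest -/

section Forest

variable {w : List Letter} {x y : HalfEdges w} {i n : ℕ} {t T : PlaneTree} {ts ts' : List PlaneTree}

theorem origin_injective : Function.Injective (origin w) := Subtype.val_injective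

/-- The half-edge `x` of the prefix-map survives in the prefix-forest, where the planted plane
tree explored from it is `t`. -/
def ForestShape (w : List Letter) (x : HalfEdges w) (t : PlaneTree) : Prop :=
  ∃ r, origin w r = x ∧ (prefixForest w).HasShape r t

/-- The first half-edge found in the prefix-forest from the position `x` of the prefix-map, skipping
the tails of the active edges, has the corner `T`. -/
def ForestCorner (w : List Letter) (x : HalfEdges w) (T : PlaneTree) : Prop :=
  (prefixMap w).HasCornerAfterDelete (isActiveTail w) x T

theorem ForestCorner.of_head (hx : (prefixMap w).isHead x = true) :
    ForestCorner w ((prefixMap w).next x) .τ :=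
  OrientedMap.HasCornerAfterDelete.of_head (isActiveTail_eq_false_of_isHead hx) hx

theorem ForestCorner.forestShape (hT : ForestCorner w x T) (hx : (prefixMap w).isHead x = true) :
    ForestShape w x T :=
  ⟨_, rfl, hT.hasShape (isActiveTail_eq_false_of_isHead hx) hx⟩

theorem ForestCorner.concat (hT : ForestCorner w x T) (hx : (prefixMap w).isHead x = false)
    (hkept : isActiveTail w x = false) (hxy : LinkedAny w x y) (hy : ForestShape w y t) :
    ForestCorner w ((prefixMap w).next x) (.σ t T) := by
  obtain ⟨r, rfl, ht⟩ := hy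
  have mate_x : (prefixMap w).mate x = origin w r := mate_eq hxy
  have mate_ne : (prefixMap w).mate x ≠ x := fun h => by
    rw [← mate_x, h] at hxy
    exact hxy.elim (fun h => h.2.2.elim (·.1.false) (·.1.false))
      (fun h => h.2.2.elim (·.1.false) (·.1.false))
  have mate_kept : isActiveTail w ((prefixMap w).mate x) = false := mate_x ▸ r.2
  have mate_eq_r : (⟨_, mate_kept⟩ : {y // isActiveTail w y = false}) = r := Subtype.ext mate_x
  exact OrientedMap.HasCornerAfterDelete.concat hT hkept hx mate_ne mate_kept (mate_eq_r ▸ ht)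

/-- After the first `n` letters of `w`, the trees of the tree-sequence are the trees carried by the
heads of the pending letters `b`, and the trees under construction at the current position of the
tour and at the pending letters `a`. -/
structure TreesAt (w : List Letter) (n : ℕ) (ts ts' : List PlaneTree) : Prop where
  lambda0_eq : lambda0 (w.take n) = treeSequence ts.reverse ts'.reverse
  heads : List.Forall₂ (fun i t => ForestShape w (halfEdge w i) t) (pending .b .bBar (plus w) n) ts
  corners : List.Forall₂ (fun i T => ForestCorner w (halfEdge w i) T)
    (n :: pending .a .aBar (plus w) n) ts'

theorem treesAt_zero (w : List Letter) : TreesAt w 0 [] [.τ] where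
  lambda0_eq := rfl
  heads := .nil
  corners := by
    have next_zero : (prefixMap w).next (0 : HalfEdges w) = halfEdge w 0 := by
      rw [next_apply, treeMate_eq_self (by simp [letterAt]) (by simp [letterAt]), zero_add]
      rfl
    rw [pending]
    refine .cons ?_ .nil
    rw [← next_zero]
    exact .of_head rfl

theorem TreesAt.succ_b (h : TreesAt w n ts ts') (hl : w[n]? = some .b) :
    ∃ ts₁ ts₁', TreesAt w (n + 1) ts₁ ts₁' := by
  have hl' := getElem?_plus_of_eq_some hl
  have hn := (lt_length_of_getElem?_eq_some hl').le
  have hhead := isHead_halfEdge_of_eq_some hl'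
  obtain ⟨hlambda, hheads, - | @⟨_, T, _, ts₂', hT, hcorners⟩⟩ := h
  refine ⟨T :: ts, .τ :: ts₂', ?_, ?_, ?_⟩
  · rw [lambda0_take_succ hl, hlambda, List.reverse_cons, lambda0Step_b_treeSequence,
      List.reverse_cons, List.reverse_cons]
  · rw [pending_succ_of_open hl']
    exact .cons (hT.forestShape hhead) hheads
  · rw [pending_succ_of_ne (by simp [hl']) (by simp [hl'])]
    refine .cons ?_ hcorners
    rw [← next_halfEdge_of_ne hn (by simp [hl']) (by simp [hl'])]
    exact .of_head hhead

theorem filter_finRange_eq {c d : Letter} (hcd : c ≠ d) {p : HalfEdges w → Bool}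
    (hp : ∀ n ≤ (plus w).length, p (halfEdge w n) = true ↔ NonPaired c d w n) :
    (List.finRange _).filter p = ((pending c d (plus w) w.length).map (halfEdge w)).reverse := by
  have le_of_mem {i : ℕ} (hi : i ∈ pending c d (plus w) w.length) : i + 1 ≤ (plus w).length :=
    (lt_of_mem_pending hi).trans_le (length_le_length_plus w)
  refine List.Pairwise.eq_of_mem_iff (r := (· < ·)) ((List.pairwise_lt_finRange _).filter _) ?_ ?_
  · rw [List.pairwise_reverse, List.pairwise_map]
    refine (pairwise_gt_pending c d _ _).imp_of_mem fun {i j} hi hj hij => ?_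
    rw [Fin.lt_def, halfEdge_val (le_of_mem hi), halfEdge_val (le_of_mem hj)]
    exact Nat.succ_lt_succ hij
  · intro x
    obtain ⟨n, hn, rfl⟩ := exists_halfEdge_eq x
    simp only [List.mem_filter, List.mem_finRange, true_and, List.mem_map, List.mem_reverse,
      hp n hn, nonPaired_iff_mem_pending hcd, ← pending_plus le_rfl]
    refine ⟨fun h => ⟨n, h, rfl⟩, fun ⟨i, hi, h⟩ => ?_⟩
    have hpos := congrArg (position w) h
    rw [position_halfEdge (Nat.le_of_succ_le (le_of_mem hi)), position_halfEdge hn] at hpos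
    exact hpos ▸ hi

theorem danglingHeads_eq (w : List Letter) :
    danglingHeads w = ((pending .b .bBar (plus w) w.length).map (halfEdge w)).reverse :=
  filter_finRange_eq (by decide) fun _ => isDanglingHead_halfEdge_iff

theorem rootingHeads_eq (w : List Letter) : rootingHeads w =
    (((pending .a .aBar (plus w) w.length).map (halfEdge w)).map (treeMate w) ++ [0]).reverse := by
  rw [rootingHeads, filter_finRange_eq (by decide) fun _ => isActiveTail_halfEdge_iff,
    List.reverse_append, List.map_reverse, List.reverse_singleton, List.singleton_append]

theorem exists_of_forall₂_of_mem {α β : Type*} {R : α → β → Prop} {l : List α} {u : List β}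
    (h : List.Forall₂ R l u) {a : α} (ha : a ∈ l) : ∃ b, R a b := by
  induction h with
  | nil => cases ha
  | cons hab _ ih => exact (List.mem_cons.mp ha).elim (fun h => ⟨_, h ▸ hab⟩) ih

/-- The connected component in the prefix-forest of the half-edge coming from `x`, rooted at this
half-edge, is the planted plane tree `t`. -/
def IsForestTree (w : List Letter) (x : HalfEdges w) (t : PlaneTree) : Prop :=
  ∃ r, origin w r = x ∧ (prefixForest w).IsTreeAt r t

variable (hw : IsPrefixShuffle w)
include hw

theorem TreesAt.succ_a (h : TreesAt w n ts ts') (hl : w[n]? = some .a) :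
    TreesAt w (n + 1) ts (.τ :: ts') := by
  have hl' := getElem?_plus_of_eq_some hl
  obtain ⟨m, hm⟩ := exists_paired_of_a hw hl'
  refine ⟨?_, ?_, ?_⟩
  · rw [lambda0_take_succ hl, h.lambda0_eq, lambda0Step_a_treeSequence, List.reverse_cons]
  · rw [pending_succ_of_ne (by simp [hl']) (by simp [hl'])]
    exact h.heads
  · rw [pending_succ_of_open hl']
    refine .cons ?_ h.corners
    rw [← hm.next_halfEdge_right]
    exact .of_head (isHead_halfEdge_of_eq_some hm.2.2.1)

theorem TreesAt.succ_aBar (h : TreesAt w n ts ts') (hl : w[n]? = some .aBar) :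
    ∃ ts₁', TreesAt w (n + 1) ts ts₁' := by
  have hl' := getElem?_plus_of_eq_some hl
  obtain ⟨i, l, hpending⟩ := exists_pending_eq_cons (c := .a) (by decide)
    (isPrefixShuffle_plus hw).count_aBar_le hl'
  have hi := paired_of_pending_eq_cons (by decide) hpending hl'
  have not_active : isActiveTail w (halfEdge w i) = false :=
    Bool.eq_false_of_not_eq_true
      (hi.isActiveTail_halfEdge_iff.not.mpr (lt_length_of_getElem?_eq_some hl).not_ge)
  obtain ⟨hlambda, hheads, hcorners⟩ := h
  rw [hpending] at hcorners
  obtain - | @⟨_, T₁, _, _, hT₁, - | @⟨_, T₂, _, ts₂', hT₂, hcorners⟩⟩ := hcorners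
  refine ⟨.σ T₁ T₂ :: ts₂', ?_, ?_, ?_⟩
  · rw [lambda0_take_succ hl, hlambda, List.reverse_cons, List.reverse_cons, List.append_assoc]
    simp only [List.singleton_append, lambda0Step_aBar_treeSequence, List.reverse_cons]
  · rw [pending_succ_of_ne (by simp [hl']) (by simp [hl'])]
    exact hheads
  · rw [pending_succ_of_close (by decide) hl', hpending]
    refine .cons ?_ hcorners
    rw [← hi.next_halfEdge_left]
    exact hT₂.concat (isHead_halfEdge_of_eq_some hi.2.1) not_active (.inl hi.linked)
      (hT₁.forestShape (isHead_halfEdge_of_eq_some hl'))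

theorem TreesAt.succ_bBar (h : TreesAt w n ts ts') (hl : w[n]? = some .bBar) :
    ∃ ts₁ ts₁', TreesAt w (n + 1) ts₁ ts₁' := by
  have hl' := getElem?_plus_of_eq_some hl
  have hn := (lt_length_of_getElem?_eq_some hl').le
  obtain ⟨i, l, hpending⟩ := exists_pending_eq_cons (c := .b) (by decide)
    (isPrefixShuffle_plus hw).count_bBar_le hl'
  have hi := paired_of_pending_eq_cons (by decide) hpending hl'
  have not_active : isActiveTail w (halfEdge w n) = false :=
    Bool.eq_false_of_not_eq_true fun h => by
      simp [((isActiveTail_halfEdge_iff hn).mp h).getElem?_plus] at hl'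
  obtain ⟨hlambda, hheads, hcorners⟩ := h
  rw [hpending] at hheads
  obtain - | @⟨_, t₁, _, ts₂, ht₁, hheads⟩ := hheads
  obtain - | @⟨_, T₂, _, ts₂', hT₂, hcorners⟩ := hcorners
  refine ⟨ts₂, .σ t₁ T₂ :: ts₂', ?_, ?_, ?_⟩
  · rw [lambda0_take_succ hl, hlambda, List.reverse_cons, List.reverse_cons,
      lambda0Step_bBar_treeSequence, List.reverse_cons]
  · rwa [pending_succ_of_close (by decide) hl', hpending]
  · rw [pending_succ_of_ne (by simp [hl']) (by simp [hl'])]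
    refine .cons ?_ hcorners
    rw [← next_halfEdge_of_ne hn (by simp [hl']) (by simp [hl'])]
    exact hT₂.concat (isHead_halfEdge_of_eq_some hl') not_active (.inr hi.linked.symm) ht₁

theorem exists_treesAt (hn : n ≤ w.length) : ∃ ts ts', TreesAt w n ts ts' := by
  induction n with
  | zero => exact ⟨_, _, treesAt_zero w⟩
  | succ n ih =>
    obtain ⟨ts, ts', h⟩ := ih (Nat.le_of_succ_le hn)
    rcases hl : w[n] with _ | _ | _ | _ <;>
      replace hl := List.getElem?_eq_some_iff.mpr ⟨hn, hl⟩
    · exact ⟨_, _, h.succ_a hw hl⟩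
    · exact ⟨_, h.succ_aBar hw hl⟩
    · exact h.succ_b hl
    · exact h.succ_bBar hw hl

theorem forall₂_forestShape_of_forestCorner (hn : n ≤ (plus w).length) (hwn : w.length ≤ n)
    (h : List.Forall₂ (fun i T => ForestCorner w (halfEdge w i) T)
      (n :: pending .a .aBar (plus w) n) ts') :
    List.Forall₂ (ForestShape w)
      (((pending .a .aBar (plus w) n).map (halfEdge w)).map (treeMate w) ++ [0]) ts' := by
  induction hn using Nat.decreasingInduction generalizing ts' with
  | self =>
    rw [pending_length_plus hw] at h ⊢
    obtain - | @⟨_, T, _, _, hT, ⟨⟩⟩ := h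
    rw [halfEdge_length] at hT
    exact .cons (hT.forestShape rfl) .nil
  | of_succ n hn ih =>
    have hl := getElem?_plus_of_le hwn hn
    obtain ⟨i, l, hpending⟩ := exists_pending_eq_cons (c := .a) (by decide)
      (isPrefixShuffle_plus hw).count_aBar_le hl
    have hi := paired_of_pending_eq_cons (by decide) hpending hl
    rw [pending_succ_of_close (by decide) hl, hpending] at ih
    rw [hpending] at h ⊢
    obtain - | @⟨_, T₁, _, _, hT₁, - | @⟨_, T₂, _, ts₂', hT₂, hcorners⟩⟩ := h
    have hT₂' := hT₂.next_of_deleted (hi.isActiveTail_halfEdge_iff.mpr hwn)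
    rw [hi.next_halfEdge_left] at hT₂'
    rw [List.map_cons, List.map_cons, treeMate_eq hi.linked]
    exact .cons (hT₁.forestShape (isHead_halfEdge_of_eq_some hl))
      (ih (hwn.trans n.le_succ) (.cons hT₂' hcorners))

theorem origin_mem_heads_iff {r : (prefixForest w).HalfEdge} :
    origin w r ∈ danglingHeads w ++ rootingHeads w ↔
      (prefixForest w).isHead r = true ∧ (prefixForest w).mate r = r :=
  (mem_heads_iff hw).trans (and_congr_right' OrientedMap.delete_mate_eq_self_iff.symm)

theorem climbing_delete_activeTails :
    ((prefixMap w).delete (isActiveTail w)).Climbing (fun x => position w x.1) :=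
  (climbing_prefixMap hw).delete fun _ => isHead_of_isActiveTail

theorem exists_root_joined (x : (prefixForest w).HalfEdge) :
    ∃ r, origin w r ∈ danglingHeads w ++ rootingHeads w ∧ (prefixForest w).Joined r x := by
  obtain ⟨r, hr, hmate, hrx⟩ := (climbing_delete_activeTails hw).exists_root x
  exact ⟨r, (origin_mem_heads_iff hw).mpr ⟨hr, hmate⟩, hrx⟩

theorem ForestShape.isForestTree (h : ForestShape w x t)
    (hx : x ∈ danglingHeads w ++ rootingHeads w) : IsForestTree w x t := by
  obtain ⟨r, rfl, ht⟩ := h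
  obtain ⟨hr, hmate⟩ := (origin_mem_heads_iff hw).mp hx
  exact ⟨r, rfl, ht.isTreeAt
    (OrientedMap.hasUniqueHeads_explode (climbing_delete_activeTails hw).isHead_firstHead) hr hmate⟩

theorem forall₂_isForestTree {l : List (HalfEdges w)}
    (hl : l ⊆ danglingHeads w ++ rootingHeads w) (h : List.Forall₂ (ForestShape w) l ts) :
    List.Forall₂ (IsForestTree w) l ts :=
  ((List.forall₂_and_left _ _).mpr ⟨fun _ hx => hl hx, h⟩).imp fun _ _ h => h.2.isForestTree hw h.1

theorem exists_forall₂_isForestTree : ∃ ts ts',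
    List.Forall₂ (IsForestTree w) (danglingHeads w) ts ∧
      List.Forall₂ (IsForestTree w) (rootingHeads w) ts' ∧ lambda0 w = treeSequence ts ts' := by
  obtain ⟨ts, ts', hlambda, hheads, hcorners⟩ := exists_treesAt hw le_rfl
  rw [List.take_length] at hlambda
  refine ⟨ts.reverse, ts'.reverse, forall₂_isForestTree hw (List.subset_append_left _ _) ?_,
    forall₂_isForestTree hw (List.subset_append_right _ _) ?_, hlambda⟩
  · rw [danglingHeads_eq, List.forall₂_reverse_iff, List.forall₂_map_left_iff]
    exact hheads
  · rw [rootingHeads_eq, List.forall₂_reverse_iff]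
    exact forall₂_forestShape_of_forestCorner hw (length_le_length_plus w) le_rfl hcorners

theorem exists_isForestTree (hx : x ∈ danglingHeads w ++ rootingHeads w) :
    ∃ t, IsForestTree w x t := by
  obtain ⟨ts, ts', hts, hts', -⟩ := exists_forall₂_isForestTree hw
  exact exists_of_forall₂_of_mem (List.rel_append hts hts') hx

theorem existsUnique_root_joined (x : (prefixForest w).HalfEdge) :
    ∃! r, origin w r ∈ danglingHeads w ++ rootingHeads w ∧ (prefixForest w).Joined r x := by
  obtain ⟨r, hr, hrx⟩ := exists_root_joined hw x
  obtain ⟨t, r₁, hr₁, ht⟩ := exists_isForestTree hw hr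
  obtain rfl := origin_injective hr₁
  refine ⟨r₁, ⟨hr, hrx⟩, fun r' ⟨hr', hr'x⟩ => ht.eq_of_joined ?_ ?_⟩
  · exact hrx.trans _ _ _ (.symm _ _ hr'x)
  · exact ((origin_mem_heads_iff hw).mp hr').2

end Forest

end PrefixShuffle

theorem mainTheorem5 (w : List PrefixShuffle.Letter) (hw : PrefixShuffle.IsPrefixShuffle w) :
    ∃ ts ts' : List PrefixShuffle.PlaneTree,
      -- the component of the `i`-th dangling head, rooted at this head, is the tree `t_i`
      List.Forall₂ (fun h t => ∃ r : (PrefixShuffle.prefixForest w).HalfEdge,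
          PrefixShuffle.origin w r = h ∧ (PrefixShuffle.prefixForest w).IsTreeAt r t)
        (PrefixShuffle.danglingHeads w) ts ∧
      -- the component of the `i`-th rooting head, rooted at this head, is the tree `t'_i`
      List.Forall₂ (fun h t => ∃ r : (PrefixShuffle.prefixForest w).HalfEdge,
          PrefixShuffle.origin w r = h ∧ (PrefixShuffle.prefixForest w).IsTreeAt r t)
        (PrefixShuffle.rootingHeads w) ts' ∧
      -- these are `k + l` distinct components, and there is no other one
      (PrefixShuffle.danglingHeads w ++ PrefixShuffle.rootingHeads w).Nodup ∧
      (∀ x : (PrefixShuffle.prefixForest w).HalfEdge,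
        ∃! r : (PrefixShuffle.prefixForest w).HalfEdge,
          PrefixShuffle.origin w r ∈
            PrefixShuffle.danglingHeads w ++ PrefixShuffle.rootingHeads w ∧
          (PrefixShuffle.prefixForest w).Joined r x) ∧
      PrefixShuffle.lambda0 w = PrefixShuffle.treeSequence ts ts' := by
  obtain ⟨ts, ts', hts, hts', hlambda⟩ := PrefixShuffle.exists_forall₂_isForestTree hw
  exact ⟨ts, ts', hts, hts', PrefixShuffle.nodup_heads hw,
    PrefixShuffle.existsUnique_root_joined hw, hlambda⟩
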